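/- Let $d\in\{2,3\}$, let $\Omega\subset\mathbb R^d$ be a bounded open set and let $\nu>0$. Put $V=[H^1_0(\Omega)]^d$ (the $H^1$-closure of $[C_c^\infty(\Omega)]^d$) with $\|v\|_V=\|\nabla v\|_{L^2(\Omega)}$, and $Q=L^2_0(\Omega)$ (mean-zero functions in $L^2(\Omega)$). Let $(\cdot,\cdot)$ be the $L^2$ inner product and $$a(u,v)=\nu(\nabla u,\nabla v),\qquad b(v,q)=-(\nabla\cdot v,q),\qquad \|f\|_{V'}=\sup_{0\ne v\in V}\frac{(f,v)}{\|v\|_V}.$$ There is a constant $C>0$, depending only on $d$, $\Omega$ and $\nu$, such that the following holds for every $f\in[L^2(\Omega)]^d$ and for all finite-dimensional subspaces $V_h\subset V$, $Q_h\subset Q$ (for instance Taylor–Hood finite element spaces) that satisfy the discrete inf-sup condition: for some $\beta_h>0$, $$\beta_h\le \inf_{0\ne q_h\in Q_h}\ \sup_{0\ne v_h\in V_h}\frac{|b(v_h,q_h)|}{\|v_h\|_V\|q_h\|_{L^2(\Omega)}}.$$ Set $\mathfrak u_h^0=f$ and, for $1\le i\le \ell$, let $(\mathfrak u_h^i,\mathfrak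 p_h^i)\in V_h\times Q_h$ satisfy $$a(\mathfrak u_h^i,v_h)+b(v_h,\mathfrak p_h^i)=(\mathfrak u_h^{i-1},v_h)\quad\forall v_h\in V_h,\qquad b(\mathfrak u_h^i,q_h)=0\quad\forall q_h\in Q_h .$$ Let $\varphi_1,\dots,\varphi_N$ be a basis of $V_h$, let $A_{ij}=a(\varphi_j,\varphi_i)$, let $1\le r\le\ell$ be such that $\mathfrak u_h^1,\dots,\mathfrak u_h^r$ are linearly independent, let $U_r\in\mathbb R^{N\times r}$ be the matrix whose $i$-th column is the coefficient vector of $\mathfrak u_h^i$ in this basis, and let $K_r=U_r^\top A U_r$. Then $K_r$ is a real symmetric Hankel matrix, its eigenvalues (with multiplicity) $\lambda_1(K_r)\ge\dots\ge\lambda_r(K_r)=\lambda_{\min}(K_r)$ are positive, $$\lambda_{2k+1}(K_r)\le 16\left[\exp\left(\frac{\pi^2}{4\log(8\lfloor r/2\rfloor/\pi)}\right)\right]^{-2k+2}\lambda_1(K_r)\qquad\text{for all integers } k\ge0 \text{ with } 2k+1\le r$$ (for $r=1$ the bracket is read as $1$), and $$\lambda_{\min}(K_r)\le C\,(2r-1)\,\|f\|_{V'}^2\,\exp\left(-\frac{7(r+1)}2\right).$$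 -/

import Mathlib

open MeasureTheory
open scoped ContDiff

noncomputable section

namespace StokesROM

variable {d : ℕ}

/-- `ℝ^d` with its Euclidean norm. -/
abbrev Pt (d : ℕ) := EuclideanSpace ℝ (Fin d)

/-- `[L²(Ω)]^d`. -/
abbrev L2Field (Ω : Set (Pt d)) := Lp (Pt d) 2 (volume.restrict Ω)

/-- `[L²(Ω)]^{d × d}` (pointwise Frobenius inner product), the home of velocity gradients. -/
abbrev L2Tensor (Ω : Set (Pt d)) :=
  Lp (EuclideanSpace ℝ (Fin d × Fin d)) 2 (volume.restrict Ω)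

/-- The Jacobian of a differentiable vector field; the entry `(i, j)` is `∂_j φ_i`. -/
def jacobian (φ : Pt d → Pt d) (x : Pt d) : EuclideanSpace ℝ (Fin d × Fin d) :=
  WithLp.toLp 2 fun ij => fderiv ℝ φ x (EuclideanSpace.single ij.2 1) ij.1

/-- All pairs `(φ, ∇φ)`, as elements of `L² × L²`, with `φ ∈ [C_c^∞(Ω)]^d`. -/
def testPairs (Ω : Set (Pt d)) : Set (L2Field Ω × L2Tensor Ω) :=
  {w | ∃ φ : Pt d → Pt d, ContDiff ℝ ∞ φ ∧ HasCompactSupport φ ∧ tsupport φ ⊆ Ω ∧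
    (w.1 : Pt d → Pt d) =ᵐ[volume.restrict Ω] φ ∧
    (w.2 : Pt d → EuclideanSpace ℝ (Fin d × Fin d)) =ᵐ[volume.restrict Ω] jacobian φ}

/-- `[H¹₀(Ω)]^d`, the closure of `[C_c^∞(Ω)]^d` in the `H¹` norm. A function `v` of the space is
represented by the pair `(v, ∇v)`; the second entry is the weak gradient of the first one, as a
limit in `L²` of gradients of test fields, so it is determined by `v`. -/
def H10 (Ω : Set (Pt d)) : Submodule ℝ (L2Field Ω × L2Tensor Ω) :=
  (Submodule.span ℝ (testPairs Ω)).topologicalClosure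

/-- The velocity space `V = [H¹₀(Ω)]^d`. -/
abbrev VelocitySpace (Ω : Set (Pt d)) := ↥(H10 Ω)

/-- The function underlying an element of `V`, in `[L²(Ω)]^d`. -/
def val {Ω : Set (Pt d)} (v : VelocitySpace Ω) : L2Field Ω := v.1.1

/-- The weak gradient of an element of `V`. -/
def grad {Ω : Set (Pt d)} (v : VelocitySpace Ω) : L2Tensor Ω := v.1.2

/-- `L²₀(Ω)`: the square integrable functions of mean zero. (On a set of finite measure the
integrability is automatic.) -/
def L20 (Ω : Set (Pt d)) : Submodule ℝ (Lp ℝ 2 (volume.restrict Ω)) where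
  carrier := {q | Integrable (q : Pt d → ℝ) (volume.restrict Ω) ∧ ∫ x in Ω, q x = 0}
  zero_mem' := by
    have h := Lp.coeFn_zero ℝ 2 (volume.restrict Ω)
    refine ⟨(integrable_zero _ _ _).congr h.symm, ?_⟩
    rw [integral_congr_ae h]
    simp
  add_mem' := by
    rintro p q ⟨hp, hp0⟩ ⟨hq, hq0⟩
    have h := Lp.coeFn_add p q
    refine ⟨(hp.add hq).congr h.symm, ?_⟩
    rw [integral_congr_ae h]
    simp [integral_add hp hq, hp0, hq0]
  smul_mem' := by
    rintro c q ⟨hq, hq0⟩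
    have h := Lp.coeFn_smul c q
    refine ⟨(hq.smul c).congr h.symm, ?_⟩
    rw [integral_congr_ae h]
    simp [integral_const_mul, hq0]

/-- The pressure space `Q = L²₀(Ω)`. -/
abbrev PressureSpace (Ω : Set (Pt d)) := ↥(L20 Ω)

/-- `‖v‖_V = ‖∇v‖_{L²(Ω)}`, the norm of `V = [H¹₀(Ω)]^d`. -/
def normV {Ω : Set (Pt d)} (v : VelocitySpace Ω) : ℝ := ‖grad v‖

/-- `‖f‖_{V'} = sup_{v ≠ 0} (f, v) / ‖v‖_V`. (The vector `v = 0` contributes the value `0`, which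
does not change the supremum.) -/
def dualNorm {Ω : Set (Pt d)} (f : L2Field Ω) : ℝ :=
  ⨆ v : VelocitySpace Ω, inner ℝ f (val v) / normV v

/-- `a(u, v) = ν (∇u, ∇v)`. -/
def formA {Ω : Set (Pt d)} (ν : ℝ) (u v : VelocitySpace Ω) : ℝ := ν * inner ℝ (grad u) (grad v)

/-- `b(v, q) = -(∇ · v, q)`. -/
def formB {Ω : Set (Pt d)} (v : VelocitySpace Ω) (q : PressureSpace Ω) : ℝ :=
  -∫ x in Ω, (∑ i, grad v x (i, i)) * q.1 x

/-- The discrete inf-sup condition: for some `β > 0`,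
`β ≤ inf_{q ∈ Q_h} sup_{v ∈ V_h} |b(v, q)| / (‖v‖_V ‖q‖)`. -/
def DiscreteInfSup {Ω : Set (Pt d)} (Vh : Submodule ℝ (VelocitySpace Ω))
    (Qh : Submodule ℝ (PressureSpace Ω)) : Prop :=
  ∃ β : ℝ, 0 < β ∧ ∀ q : Qh, β * ‖q‖ ≤ ⨆ v : Vh, |formB (v : VelocitySpace Ω) q| / normV v.1

/-- The load of the successive stationary Stokes problems: `f` for the first one, and afterwards
the preceding velocity. -/
def load {Ω : Set (Pt d)} {Vh : Submodule ℝ (VelocitySpace Ω)} (f : L2Field Ω) (u : ℕ → Vh) :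
    ℕ → L2Field Ω
  | 0 => f
  | i + 1 => val (u i).1

/-- `(u i, p i)`, `i < ℓ`, is the `(i+1)`-st pair of discrete velocity and pressure snapshots. -/
def IsSnapshotSequence {Ω : Set (Pt d)} (ν : ℝ) (f : L2Field Ω)
    {Vh : Submodule ℝ (VelocitySpace Ω)} {Qh : Submodule ℝ (PressureSpace Ω)}
    (ℓ : ℕ) (u : ℕ → Vh) (p : ℕ → Qh) : Prop :=
  ∀ i < ℓ,
    (∀ v : Vh, formA ν (u i).1 v.1 + formB v.1 (p i).1 = inner ℝ (load f u i) (val v.1)) ∧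
    (∀ q : Qh, formB (u i).1 q.1 = 0)

/-- The stiffness matrix `A_{ij} = a(φ_j, φ_i)`. -/
def stiffness {Ω : Set (Pt d)} (ν : ℝ) {Vh : Submodule ℝ (VelocitySpace Ω)} {N : ℕ}
    (φ : Module.Basis (Fin N) ℝ Vh) : Matrix (Fin N) (Fin N) ℝ :=
  Matrix.of fun i j => formA ν (φ j).1 (φ i).1

/-- The matrix `U_r = [u_1 | ... | u_r]` of the coefficient vectors of the velocity snapshots. -/
def coeffMatrix {Ω : Set (Pt d)} {Vh : Submodule ℝ (VelocitySpace Ω)} {N : ℕ}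
    (φ : Module.Basis (Fin N) ℝ Vh) (u : ℕ → Vh) (r : ℕ) : Matrix (Fin N) (Fin r) ℝ :=
  Matrix.of fun j i => φ.repr (u i) j

/-- `K_r = U_rᵀ A U_r`. -/
def snapshotGram {Ω : Set (Pt d)} (ν : ℝ) {Vh : Submodule ℝ (VelocitySpace Ω)} {N : ℕ}
    (φ : Module.Basis (Fin N) ℝ Vh) (u : ℕ → Vh) (r : ℕ) : Matrix (Fin r) (Fin r) ℝ :=
  (coeffMatrix φ u r).transpose * stiffness ν φ * coeffMatrix φ u r

/-- The `(i+1)`-st largest eigenvalue, counted with multiplicity, of a real symmetric matrix. -/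
def sortedEigenvalue {r : ℕ} {K : Matrix (Fin r) (Fin r) ℝ} (hK : K.IsHermitian) (i : Fin r) : ℝ :=
  hK.eigenvalues₀ (Fin.cast (Fintype.card_fin r).symm i)

end StokesROM

end

/-!
On the span of the snapshots let `S` be the operator with `a(S v, w) = (v, w)`. It is self-adjoint
and nonnegative for `a`, and maps each snapshot to the next because the pressure terms cancel. In an
`a`-orthonormal eigenbasis of `S`, `K_r` therefore becomes the Hankel matrix of the moments of a
discrete measure on `[0, ∞)`.

Regard vectors as polynomials `P`; their norm is, up to a factor, the `ℓ²` norm of the values at the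
roots of `z ^ n = -1`, and the quadratic form of `K_r` is a weighted `ℓ²` norm of the values on
`[0, ∞)`. If `p` and `q` have degree `2 k`, `|p| ≤ M |q|` on `[0, ∞)` and `|q| ≤ M |p|` at the
roots, then comparing `p R` with `q R` on the subspace of multiples of `p` gives
`λ_{2 k + 1} ≤ M ^ 4 λ_1` by the min-max principle. Such `p` and `q` are products of quadratic
factors which become `y - α i` and `y + α i` after a rational substitution turning both sets into
opposite intervals. For `α i` equidistant on the logarithmic scale, `log M` is minus a sum of
equidistant values of `log coth`, which the trapezoidal rule compares with an integral equal to
`π ^ 2 / 4`.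

For the smallest eigenvalue one tests with a monic polynomial vanishing at all large nodes. The
number of nodes above a fixed threshold is bounded independently of the discretization because the
embedding of `H¹₀` in `L²` is compact.
-/

namespace StokesROM

section MinMax

open Matrix WithLp

variable {n : ℕ} {K : Matrix (Fin n) (Fin n) ℝ}

/-- An orthonormal basis of eigenvectors of `K`, the `j`-th one belonging to
`sortedEigenvalue hK j`. -/
noncomputable def sortedEigenvectorBasis (hK : K.IsHermitian) :
    OrthonormalBasis (Fin n) ℝ (EuclideanSpace ℝ (Fin n)) :=
  hK.eigenvectorBasis.reindex <|
    (Fintype.equivOfCardEq (Fintype.card_fin _)).symm.trans (finCongr (Fintype.card_fin n))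

theorem mulVec_sortedEigenvectorBasis (hK : K.IsHermitian) (j : Fin n) :
    K *ᵥ ofLp (sortedEigenvectorBasis hK j) =
      sortedEigenvalue hK j • ofLp (sortedEigenvectorBasis hK j) := by
  simp [sortedEigenvectorBasis, hK.mulVec_eigenvectorBasis, IsHermitian.eigenvalues,
    sortedEigenvalue]

theorem dotProduct_eq_inner (x y : Fin n → ℝ) : x ⬝ᵥ y = inner ℝ (toLp 2 x) (toLp 2 y) := by
  simp [EuclideanSpace.inner_toLp_toLp, dotProduct_comm]

theorem dotProduct_self_eq_sum_sq (hK : K.IsHermitian) (x : Fin n → ℝ) :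
    x ⬝ᵥ x = ∑ j, inner ℝ (sortedEigenvectorBasis hK j) (toLp 2 x) ^ 2 := by
  rw [dotProduct_eq_inner, real_inner_self_eq_norm_sq,
    ← (sortedEigenvectorBasis hK).sum_sq_inner_right]

theorem dotProduct_mulVec_eq_sum_sq (hK : K.IsHermitian) (x : Fin n → ℝ) :
    x ⬝ᵥ K *ᵥ x =
      ∑ j, sortedEigenvalue hK j * inner ℝ (sortedEigenvectorBasis hK j) (toLp 2 x) ^ 2 := by
  have hcoord (j : Fin n) : inner ℝ (sortedEigenvectorBasis hK j) (toLp 2 (K *ᵥ x)) =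
      sortedEigenvalue hK j * inner ℝ (sortedEigenvectorBasis hK j) (toLp 2 x) := by
    rw [← toLp_ofLp 2 (sortedEigenvectorBasis hK j), ← dotProduct_eq_inner, ← dotProduct_eq_inner,
      dotProduct_mulVec, ← mulVec_transpose, (isHermitian_iff_isSymm.1 hK).eq,
      mulVec_sortedEigenvectorBasis, smul_dotProduct, smul_eq_mul]
  rw [dotProduct_eq_inner, ← (sortedEigenvectorBasis hK).sum_inner_mul_inner]
  exact Finset.sum_congr rfl fun j _ => by rw [hcoord, real_inner_comm]; ring

theorem sortedEigenvalue_antitone (hK : K.IsHermitian) : Antitone (sortedEigenvalue hK) :=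
  fun i j hij => hK.eigenvalues₀_antitone (show (i : ℕ) ≤ j from hij)

theorem sortedEigenvalue_pos (hK : K.PosDef) (i : Fin n) : 0 < sortedEigenvalue hK.1 i := by
  have h := hK.eigenvalues_pos
    (Fintype.equivOfCardEq (Fintype.card_fin _) (Fin.cast (Fintype.card_fin n).symm i))
  rwa [IsHermitian.eigenvalues, Equiv.symm_apply_apply] at h

theorem sortedEigenvalue_le_of_subspace (hK : K.IsHermitian) (i : Fin n) (c : ℝ)
    (S : Submodule ℝ (Fin n → ℝ)) (hS : n ≤ Module.finrank ℝ S + i)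
    (h : ∀ x ∈ S, x ⬝ᵥ K *ᵥ x ≤ c * (x ⬝ᵥ x)) : sortedEigenvalue hK i ≤ c := by
  let coord (j : Fin n) : (Fin n → ℝ) →ₗ[ℝ] ℝ :=
    innerₛₗ ℝ (sortedEigenvectorBasis hK j) ∘ₗ (WithLp.linearEquiv 2 ℝ (Fin n → ℝ)).symm.toLinearMap
  let tail : S →ₗ[ℝ] (Finset.Ioi i → ℝ) := LinearMap.pi fun j => coord j ∘ₗ S.subtype
  have hker : LinearMap.ker tail ≠ ⊥ := by
    apply LinearMap.ker_ne_bot_of_finrank_lt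
    rw [Module.finrank_fintype_fun_eq_card, Fintype.card_coe, Fin.card_Ioi]
    omega
  obtain ⟨⟨x, hxS⟩, hx, hx0⟩ := Submodule.exists_mem_ne_zero_of_ne_bot hker
  have htail (j : Fin n) (hj : i < j) : inner ℝ (sortedEigenvectorBasis hK j) (toLp 2 x) = 0 :=
    congrFun (LinearMap.mem_ker.1 hx) ⟨j, Finset.mem_Ioi.2 hj⟩
  have hpos : 0 < x ⬝ᵥ x :=
    dotProduct_star_self_pos_iff.2 fun h0 => hx0 (Subtype.ext h0)
  refine le_of_mul_le_mul_right (le_trans ?_ (h x hxS)) hpos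
  rw [dotProduct_mulVec_eq_sum_sq hK, dotProduct_self_eq_sum_sq hK, Finset.mul_sum]
  refine Finset.sum_le_sum fun j _ => ?_
  rcases lt_or_ge i j with hj | hj
  · simp [htail j hj]
  · exact mul_le_mul_of_nonneg_right (sortedEigenvalue_antitone hK hj) (sq_nonneg _)

theorem dotProduct_mulVec_le_sortedEigenvalue_zero (hK : K.IsHermitian) (hn : 0 < n)
    (x : Fin n → ℝ) : x ⬝ᵥ K *ᵥ x ≤ sortedEigenvalue hK ⟨0, hn⟩ * (x ⬝ᵥ x) := by
  rw [dotProduct_mulVec_eq_sum_sq hK, dotProduct_self_eq_sum_sq hK, Finset.mul_sum]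
  exact Finset.sum_le_sum fun j _ => mul_le_mul_of_nonneg_right
    (sortedEigenvalue_antitone hK (Nat.zero_le _)) (sq_nonneg _)

theorem sortedEigenvalue_last_mul_le (hK : K.IsHermitian) (hn : 0 < n) (x : Fin n → ℝ) :
    sortedEigenvalue hK ⟨n - 1, Nat.sub_one_lt_of_lt hn⟩ * (x ⬝ᵥ x) ≤ x ⬝ᵥ K *ᵥ x := by
  rw [dotProduct_mulVec_eq_sum_sq hK, dotProduct_self_eq_sum_sq hK, Finset.mul_sum]
  exact Finset.sum_le_sum fun j _ => mul_le_mul_of_nonneg_right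
    (sortedEigenvalue_antitone hK (Nat.le_sub_one_of_lt j.2)) (sq_nonneg _)

end MinMax

section Moments

open Matrix Polynomial

variable {n : ℕ} {K : Matrix (Fin n) (Fin n) ℝ} {ι : Type*} [Fintype ι] {w θ : ι → ℝ}

/-- `K` is the matrix of moments `∑ l, w l * θ l ^ (i + j)` of the discrete measure with weights
`w ≥ 0` at the nodes `θ ≥ 0`. -/
structure IsMomentMatrix (K : Matrix (Fin n) (Fin n) ℝ) (w θ : ι → ℝ) : Prop where
  weight_nonneg : ∀ l, 0 ≤ w l
  node_nonneg : ∀ l, 0 ≤ θ l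
  apply_eq : ∀ i j : Fin n, K i j = ∑ l, w l * θ l ^ ((i : ℕ) + j)

/-- The vector of the first `n` coefficients of a polynomial. -/
noncomputable def coeffVec (n : ℕ) : ℝ[X] →ₗ[ℝ] Fin n → ℝ := LinearMap.pi fun i => lcoeff ℝ i

theorem coeffVec_apply (P : ℝ[X]) (i : Fin n) : coeffVec n P i = P.coeff i := rfl

theorem dotProduct_coeffVec_self (P : ℝ[X]) :
    coeffVec n P ⬝ᵥ coeffVec n P = ∑ i : Fin n, P.coeff i ^ 2 := by
  simp only [dotProduct, coeffVec_apply, sq]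

theorem eq_zero_of_coeffVec_eq_zero {P : ℝ[X]} (hP : P.degree < n) (h : coeffVec n P = 0) :
    P = 0 := by
  ext i
  rcases lt_or_ge i n with hi | hi
  · exact congrFun h ⟨i, hi⟩
  · exact coeff_eq_zero_of_degree_lt (hP.trans_le (by exact_mod_cast hi))

theorem eval_eq_sum_coeffVec {P : ℝ[X]} (hP : P.degree < n) (t : ℝ) :
    P.eval t = ∑ i : Fin n, coeffVec n P i * t ^ (i : ℕ) := by
  rcases eq_or_ne P 0 with rfl | hP0
  · simp
  · rw [eval_eq_sum_range' ((natDegree_lt_iff_degree_lt hP0).2 hP), Finset.sum_range]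
    rfl

theorem degree_mul_lt_of_natDegree_le {m : ℕ} (hm : m ≤ n) {p R : ℝ[X]} (hp : p.natDegree ≤ m)
    (hR : R.degree < (n - m : ℕ)) : (p * R).degree < n := by
  have hpm : p.degree ≤ m := degree_le_of_natDegree_le hp
  calc (p * R).degree ≤ m + R.degree := (degree_mul_le p R).trans (by gcongr)
    _ < m + (n - m : ℕ) := WithBot.add_lt_add_left (WithBot.natCast_ne_bot m) hR
    _ = n := by rw [← Nat.cast_add, Nat.add_sub_cancel' hm]

/-- The coefficient vectors of the multiples of `p` of degree less than `n`, for `p` of degree at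
most `m`. -/
noncomputable def multiplesSubspace (n m : ℕ) (p : ℝ[X]) : Submodule ℝ (Fin n → ℝ) :=
  LinearMap.range (coeffVec n ∘ₗ LinearMap.mulLeft ℝ p ∘ₗ (degreeLT ℝ (n - m)).subtype)

theorem finrank_multiplesSubspace {m : ℕ} (hm : m ≤ n) {p : ℝ[X]} (hp0 : p ≠ 0)
    (hp : p.natDegree ≤ m) : Module.finrank ℝ (multiplesSubspace n m p) = n - m := by
  rw [multiplesSubspace, LinearMap.finrank_range_of_inj, (degreeLTEquiv ℝ (n - m)).finrank_eq,
    Module.finrank_fin_fun]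
  refine (injective_iff_map_eq_zero _).2 fun R hR => Subtype.ext ?_
  exact (mul_eq_zero.1 (eq_zero_of_coeffVec_eq_zero
    (degree_mul_lt_of_natDegree_le hm hp (mem_degreeLT.1 R.2)) hR)).resolve_left hp0

namespace IsMomentMatrix

theorem isHermitian (h : IsMomentMatrix K w θ) : K.IsHermitian :=
  isHermitian_iff_isSymm.2 <| IsSymm.ext fun i j => by rw [h.apply_eq, h.apply_eq, add_comm]

theorem dotProduct_mulVec_coeffVec (h : IsMomentMatrix K w θ) {P : ℝ[X]} (hP : P.degree < n) :
    coeffVec n P ⬝ᵥ K *ᵥ coeffVec n P = ∑ l, w l * P.eval (θ l) ^ 2 := by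
  simp only [dotProduct, mulVec, h.apply_eq, eval_eq_sum_coeffVec hP, sq, Finset.mul_sum,
    Finset.sum_mul]
  calc _ = ∑ i : Fin n, ∑ l, ∑ j : Fin n,
        coeffVec n P i * (w l * θ l ^ ((i : ℕ) + j) * coeffVec n P j) :=
        Finset.sum_congr rfl fun i _ => Finset.sum_comm
    _ = _ := by
      rw [Finset.sum_comm]
      refine Finset.sum_congr rfl fun l _ => Finset.sum_congr rfl fun i _ =>
        Finset.sum_congr rfl fun j _ => ?_
      ring

theorem sum_weight_eq (h : IsMomentMatrix K w θ) (hn : 0 < n) :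
    ∑ l, w l = K ⟨0, hn⟩ ⟨0, hn⟩ := by
  simp [h.apply_eq]

theorem sortedEigenvalue_zero_nonneg (h : IsMomentMatrix K w θ) (hn : 0 < n) :
    0 ≤ sortedEigenvalue h.isHermitian ⟨0, hn⟩ := by
  have hle := dotProduct_mulVec_le_sortedEigenvalue_zero h.isHermitian hn (Pi.single ⟨0, hn⟩ 1)
  simp only [single_one_dotProduct, mulVec_single_one, col_apply, Pi.single_eq_same, mul_one,
    ← h.sum_weight_eq] at hle
  exact (Finset.sum_nonneg fun l _ => h.weight_nonneg l).trans hle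

theorem sortedEigenvalue_le_of_polynomials (h : IsMomentMatrix K w θ) {m : ℕ} (hm : m < n)
    {p q : ℝ[X]} (hp0 : p ≠ 0) (hp : p.natDegree ≤ m) (hq : q.natDegree ≤ m) {A B : ℝ} (hA : 0 ≤ A)
    (heval : ∀ l, p.eval (θ l) ^ 2 ≤ A * q.eval (θ l) ^ 2)
    (hcoeff : ∀ R : ℝ[X], R.degree < (n - m : ℕ) →
      ∑ i : Fin n, (q * R).coeff i ^ 2 ≤ B * ∑ i : Fin n, (p * R).coeff i ^ 2) :
    sortedEigenvalue h.isHermitian ⟨m, hm⟩ ≤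
      A * B * sortedEigenvalue h.isHermitian ⟨0, Nat.zero_lt_of_lt hm⟩ := by
  refine sortedEigenvalue_le_of_subspace _ _ _ (multiplesSubspace n m p)
    (by rw [finrank_multiplesSubspace hm.le hp0 hp]; exact (Nat.sub_add_cancel hm.le).ge) ?_
  rintro _ ⟨⟨R, hR⟩, rfl⟩
  replace hR := mem_degreeLT.1 hR
  set lam := sortedEigenvalue h.isHermitian ⟨0, Nat.zero_lt_of_lt hm⟩
  calc coeffVec n (p * R) ⬝ᵥ K *ᵥ coeffVec n (p * R)
      = ∑ l, w l * (p * R).eval (θ l) ^ 2 :=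
        h.dotProduct_mulVec_coeffVec (degree_mul_lt_of_natDegree_le hm.le hp hR)
    _ ≤ ∑ l, A * (w l * (q * R).eval (θ l) ^ 2) := by
        refine Finset.sum_le_sum fun l _ => ?_
        rw [eval_mul, eval_mul, mul_pow, mul_pow, mul_left_comm A, ← mul_assoc A]
        exact mul_le_mul_of_nonneg_left
          (mul_le_mul_of_nonneg_right (heval l) (sq_nonneg _)) (h.weight_nonneg l)
    _ = A * (coeffVec n (q * R) ⬝ᵥ K *ᵥ coeffVec n (q * R)) := by
        rw [h.dotProduct_mulVec_coeffVec (degree_mul_lt_of_natDegree_le hm.le hq hR),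
          Finset.mul_sum]
    _ ≤ A * (lam * (coeffVec n (q * R) ⬝ᵥ coeffVec n (q * R))) :=
        mul_le_mul_of_nonneg_left (dotProduct_mulVec_le_sortedEigenvalue_zero _ _ _) hA
    _ ≤ A * (lam * (B * (coeffVec n (p * R) ⬝ᵥ coeffVec n (p * R)))) := by
        rw [dotProduct_coeffVec_self, dotProduct_coeffVec_self]
        exact mul_le_mul_of_nonneg_left (mul_le_mul_of_nonneg_left (hcoeff R hR)
          (h.sortedEigenvalue_zero_nonneg _)) hA
    _ = A * B * lam * (coeffVec n (p * R) ⬝ᵥ coeffVec n (p * R)) := by ring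

theorem sortedEigenvalue_last_le_of_monic (h : IsMomentMatrix K w θ) (hn : 0 < n) {P : ℝ[X]}
    (hP : P.Monic) (hPn : P.natDegree < n) {B : ℝ} (hPB : ∀ l, P.eval (θ l) ^ 2 ≤ B) :
    sortedEigenvalue h.isHermitian ⟨n - 1, Nat.sub_one_lt_of_lt hn⟩ ≤ B * ∑ l, w l := by
  set x := coeffVec n P
  have hxx : 1 ≤ x ⬝ᵥ x := by
    rw [dotProduct_coeffVec_self]
    calc (1 : ℝ) = P.coeff P.natDegree ^ 2 := by rw [hP.coeff_natDegree, one_pow]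
      _ ≤ _ := Finset.single_le_sum (f := fun i : Fin n => P.coeff i ^ 2)
        (fun i _ => sq_nonneg _) (Finset.mem_univ ⟨P.natDegree, hPn⟩)
  have hquad : x ⬝ᵥ K *ᵥ x = ∑ l, w l * P.eval (θ l) ^ 2 :=
    h.dotProduct_mulVec_coeffVec ((natDegree_lt_iff_degree_lt hP.ne_zero).1 hPn)
  have hle : x ⬝ᵥ K *ᵥ x ≤ B * ∑ l, w l := by
    rw [hquad, mul_comm, Finset.sum_mul]
    exact Finset.sum_le_sum fun l _ => mul_le_mul_of_nonneg_left (hPB l) (h.weight_nonneg l)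
  have hnonneg : 0 ≤ x ⬝ᵥ K *ᵥ x :=
    hquad ▸ Finset.sum_nonneg fun l _ => mul_nonneg (h.weight_nonneg l) (sq_nonneg _)
  refine le_of_mul_le_mul_right ?_ (zero_lt_one.trans_le hxx)
  exact (sortedEigenvalue_last_mul_le h.isHermitian hn x).trans
    (hle.trans (le_mul_of_one_le_right (hnonneg.trans hle) hxx))

end IsMomentMatrix

end Moments

section OddRoots

open Polynomial Real

/-- `exp ((2 j + 1) π i / n)`; for `j < n` these are the roots of `z ^ n = -1`. -/
noncomputable def oddRoot (n j : ℕ) : ℂ := Complex.exp (((2 * j + 1) * (π / n) : ℝ) * Complex.I)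

variable {n : ℕ}

theorem norm_oddRoot (j : ℕ) : ‖oddRoot n j‖ = 1 := Complex.norm_exp_ofReal_mul_I _

theorem oddRoot_eq_mul_pow (j : ℕ) :
    oddRoot n j = oddRoot n 0 * Complex.exp (2 * π * Complex.I / n) ^ j := by
  rw [oddRoot, oddRoot, ← Complex.exp_nat_mul, ← Complex.exp_add]
  push_cast
  congr 1
  ring

theorem re_oddRoot_le {j : ℕ} (hj : j < n) : (oddRoot n j).re ≤ cos (π / n) := by
  rw [oddRoot, Complex.exp_ofReal_mul_I_re]
  set t := π / n
  have ht0 : 0 ≤ t := by positivity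
  have hj' : (j : ℝ) + 1 ≤ n := by exact_mod_cast hj
  have hnt : n * t = π := mul_div_cancel₀ _ (by linarith [(Nat.cast_nonneg j : (0 : ℝ) ≤ j)])
  have hlow : t ≤ (2 * j + 1) * t := by nlinarith [(Nat.cast_nonneg j : (0 : ℝ) ≤ j)]
  have hupp : (2 * j + 1) * t ≤ 2 * π - t := by nlinarith
  rcases le_total ((2 * j + 1) * t) π with h | h
  · exact cos_le_cos_of_nonneg_of_le_pi ht0 h hlow
  · rw [← cos_two_pi_sub]
    exact cos_le_cos_of_nonneg_of_le_pi ht0 (by linarith) (by linarith)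

theorem sum_oddRoot_pow_mul_conj_pow (a b : Fin n) :
    ∑ j : Fin n, oddRoot n j ^ (a : ℕ) * (starRingEnd ℂ) (oddRoot n j ^ (b : ℕ)) =
      if a = b then (n : ℂ) else 0 := by
  have hne (j : ℕ) : oddRoot n j ≠ 0 := Complex.exp_ne_zero _
  set ζ : ℂ := Complex.exp (2 * π * Complex.I / n)
  have hζ : IsPrimitiveRoot ζ n := Complex.isPrimitiveRoot_exp n a.pos.ne'
  have hterm (j : ℕ) : oddRoot n j ^ (a : ℕ) * (starRingEnd ℂ) (oddRoot n j ^ (b : ℕ)) =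
      oddRoot n 0 ^ ((a : ℤ) - b) * (ζ ^ ((a : ℤ) - b)) ^ j := by
    rw [map_pow, ← Complex.inv_eq_conj (norm_oddRoot j), inv_pow, ← zpow_natCast _ (a : ℕ),
      ← zpow_natCast _ (b : ℕ), ← div_eq_mul_inv, ← zpow_sub₀ (hne j), oddRoot_eq_mul_pow j,
      mul_zpow, ← zpow_natCast, ← zpow_natCast, ← zpow_mul, ← zpow_mul, mul_comm (j : ℤ)]
  simp only [hterm]
  split_ifs with hab
  · simp [hab]
  · have hne1 : ζ ^ ((a : ℤ) - b) ≠ 1 := fun h => hab <| Fin.ext <| by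
      have := Int.eq_zero_of_abs_lt_dvd ((hζ.zpow_eq_one_iff_dvd _).1 h) (by rw [abs_lt]; omega)
      omega
    have hpow : (ζ ^ ((a : ℤ) - b)) ^ n = 1 := by
      rw [← zpow_natCast, ← zpow_mul, mul_comm, zpow_mul, zpow_natCast, hζ.pow_eq_one, one_zpow]
    rw [← Finset.mul_sum, Fin.sum_univ_eq_sum_range (fun j => (ζ ^ ((a : ℤ) - b)) ^ j),
      geom_sum_eq hne1, hpow, sub_self, zero_div, mul_zero]

theorem sum_norm_aeval_oddRoot_sq {s : ℝ[X]} (hs : s.degree < n) :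
    ∑ j : Fin n, ‖aeval (oddRoot n j) s‖ ^ 2 = n * ∑ i : Fin n, s.coeff i ^ 2 := by
  have haeval (z : ℂ) : aeval z s = ∑ i : Fin n, (s.coeff i : ℂ) * z ^ (i : ℕ) := by
    rcases eq_or_ne s 0 with rfl | h0
    · simp
    · simp [aeval_eq_sum_range' ((natDegree_lt_iff_degree_lt h0).2 hs), Finset.sum_range]
  have hnorm (z : ℂ) : (‖aeval z s‖ : ℂ) ^ 2 = ∑ a : Fin n, ∑ b : Fin n,
      ((s.coeff a : ℂ) * s.coeff b) * (z ^ (a : ℕ) * (starRingEnd ℂ) (z ^ (b : ℕ))) := by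
    rw [← Complex.mul_conj', haeval, map_sum, Finset.sum_mul_sum]
    refine Finset.sum_congr rfl fun a _ => Finset.sum_congr rfl fun b _ => ?_
    rw [map_mul, Complex.conj_ofReal]
    ring
  refine Complex.ofReal_injective ?_
  push_cast
  simp_rw [hnorm]
  rw [Finset.sum_comm, Finset.mul_sum]
  refine Finset.sum_congr rfl fun a _ => ?_
  rw [Finset.sum_comm]
  simp_rw [← Finset.mul_sum, sum_oddRoot_pow_mul_conj_pow]
  simp
  ring

theorem sum_coeff_sq_le_of_norm_aeval_le (hn : 0 < n) {p q : ℝ[X]} {M : ℝ}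
    (h : ∀ z : ℂ, ‖z‖ = 1 → z.re ≤ cos (π / n) → ‖aeval z q‖ ≤ M * ‖aeval z p‖)
    (hp : p.degree < n) (hq : q.degree < n) :
    ∑ i : Fin n, q.coeff i ^ 2 ≤ M ^ 2 * ∑ i : Fin n, p.coeff i ^ 2 := by
  refine le_of_mul_le_mul_left ?_ (Nat.cast_pos.2 hn : (0 : ℝ) < n)
  rw [mul_left_comm, ← sum_norm_aeval_oddRoot_sq hq, ← sum_norm_aeval_oddRoot_sq hp,
    Finset.mul_sum]
  refine Finset.sum_le_sum fun j _ => ?_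
  rw [← mul_pow]
  exact pow_le_pow_left₀ (norm_nonneg _) (h _ (norm_oddRoot j) (re_oddRoot_le j.2)) 2

end OddRoots

section ShiftFactor

open Matrix Polynomial Real

/-- The numerator of `y - α`, where `y = (c (x + 1)² - 4 x) / (c (x + 1)² + 4 x)`. This Möbius
function of `x / (x + 1)²` maps `[0, ∞)` into `[(c - 1) / (c + 1), 1]` and an arc of the unit circle
around `-1` into the opposite interval, so that `α` and `-α` are exchanged on the arc. -/
noncomputable def shiftFactor (c α : ℝ) : ℝ[X] :=
  C ((1 - α) * c) * (X + 1) ^ 2 - C (4 * (1 + α)) * X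

theorem natDegree_shiftFactor_le (c α : ℝ) : (shiftFactor c α).natDegree ≤ 2 := by
  unfold shiftFactor
  compute_degree

theorem eval_shiftFactor (c α x : ℝ) : (shiftFactor c α).eval x =
    (c * (x + 1) ^ 2 - 4 * x) - α * (c * (x + 1) ^ 2 + 4 * x) := by
  simp only [shiftFactor, eval_sub, eval_mul, eval_C, eval_pow, eval_add, eval_X, eval_one]
  ring

theorem norm_aeval_shiftFactor (c α : ℝ) {z : ℂ} (hz : ‖z‖ = 1) : ‖aeval z (shiftFactor c α)‖ =
    |(4 - c * (2 + 2 * z.re)) + α * (4 + c * (2 + 2 * z.re))| := by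
  have hadd : z + (starRingEnd ℂ) z = 2 * z.re := by exact_mod_cast Complex.add_conj z
  have hmul : z * (starRingEnd ℂ) z = 1 := by simp [Complex.mul_conj', hz]
  have h : aeval z (shiftFactor c α) =
      -((4 - c * (2 + 2 * z.re)) + α * (4 + c * (2 + 2 * z.re)) : ℝ) * z := by
    simp only [shiftFactor, map_sub, map_mul, map_pow, map_add, map_one, aeval_C, aeval_X,
      Complex.coe_algebraMap]
    push_cast
    rw [← hadd]
    linear_combination ((α : ℂ) - 1) * c * hmul
  rw [h, norm_mul, hz, mul_one, norm_neg, Complex.norm_real, norm_eq_abs]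

variable {ι : Type*} [Fintype ι] {α : ι → ℝ} {c M : ℝ}

theorem natDegree_prod_shiftFactor_le (c : ℝ) (α : ι → ℝ) :
    (∏ i, shiftFactor c (α i)).natDegree ≤ 2 * Fintype.card ι :=
  (natDegree_prod_le _ _).trans <|
    (Finset.sum_le_card_nsmul _ _ 2 fun i _ => natDegree_shiftFactor_le c (α i)).trans_eq
      (mul_comm _ _)

theorem prod_shiftFactor_ne_zero (c : ℝ) (hα : ∀ i, 0 < α i) :
    ∏ i, shiftFactor c (α i) ≠ 0 := by
  refine Finset.prod_ne_zero_iff.2 fun i _ h => ?_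
  have heval := eval_shiftFactor c (α i) (-1)
  rw [h, eval_zero] at heval
  linarith [hα i]

theorem prod_abs_sub_mul_le {S : Set ℝ} (hM : ∀ y ∈ S, ∏ i, |y - α i| ≤ M * ∏ i, |y + α i|)
    {s t : ℝ} (hs : 0 < s) (hts : t / s ∈ S) :
    ∏ i, |t - α i * s| ≤ M * ∏ i, |t + α i * s| := by
  have hscale (a : ℝ) : |t + a * s| = s * |t / s + a| := by
    rw [← abs_of_pos hs, ← abs_mul, abs_of_pos hs, mul_add, mul_div_cancel₀ _ hs.ne', mul_comm s]
  simp only [sub_eq_add_neg, ← neg_mul, hscale, Finset.prod_mul_distrib] at hM ⊢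
  rw [mul_left_comm]
  exact mul_le_mul_of_nonneg_left (hM _ hts) (Finset.prod_nonneg fun _ _ => hs.le)

theorem abs_eval_prod_shiftFactor_le (hc : 1 < c)
    (hM : ∀ y ∈ Set.Icc ((c - 1) / (c + 1)) 1, ∏ i, |y - α i| ≤ M * ∏ i, |y + α i|)
    {x : ℝ} (hx : 0 ≤ x) :
    |(∏ i, shiftFactor c (α i)).eval x| ≤ M * |(∏ i, shiftFactor c (-α i)).eval x| := by
  simp only [eval_prod, Finset.abs_prod, eval_shiftFactor, neg_mul, sub_neg_eq_add]
  refine prod_abs_sub_mul_le hM (by positivity) ⟨?_, ?_⟩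
  · rw [div_le_div_iff₀ (by linarith) (by positivity)]
    nlinarith [sq_nonneg (x - 1)]
  · exact div_le_one_of_le₀ (by linarith) (by positivity)

theorem norm_aeval_prod_shiftFactor_le (hc : 1 < c)
    (hM : ∀ y ∈ Set.Icc ((c - 1) / (c + 1)) 1, ∏ i, |y - α i| ≤ M * ∏ i, |y + α i|)
    {z : ℂ} (hz : ‖z‖ = 1) (hzc : c ^ 2 * (1 + z.re) ≤ 2) :
    ‖aeval z (∏ i, shiftFactor c (-α i))‖ ≤ M * ‖aeval z (∏ i, shiftFactor c (α i))‖ := by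
  have hre : 0 ≤ 2 + 2 * z.re := by
    linarith [neg_le_of_abs_le ((Complex.abs_re_le_norm z).trans_eq hz)]
  simp only [map_prod, norm_prod, norm_aeval_shiftFactor c _ hz, neg_mul, ← sub_eq_add_neg]
  refine prod_abs_sub_mul_le hM (by positivity) ⟨?_, ?_⟩
  · rw [div_le_div_iff₀ (by linarith) (by positivity)]
    nlinarith
  · exact div_le_one_of_le₀ (by nlinarith) (by positivity)

theorem IsMomentMatrix.sortedEigenvalue_le_of_shifts {n : ℕ} {K : Matrix (Fin n) (Fin n) ℝ}
    {κ : Type*} [Fintype κ] {w θ : κ → ℝ} (h : IsMomentMatrix K w θ)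
    (hn : 2 * Fintype.card ι < n) (hα : ∀ i, 0 < α i) (hc : 1 < c)
    (hM : ∀ y ∈ Set.Icc ((c - 1) / (c + 1)) 1, ∏ i, |y - α i| ≤ M * ∏ i, |y + α i|)
    (hcn : c ^ 2 * (1 + cos (π / n)) ≤ 2) :
    sortedEigenvalue h.isHermitian ⟨2 * Fintype.card ι, hn⟩ ≤
      M ^ 4 * sortedEigenvalue h.isHermitian ⟨0, Nat.zero_lt_of_lt hn⟩ := by
  have hp := natDegree_prod_shiftFactor_le c α
  have hq := natDegree_prod_shiftFactor_le c fun i => -α i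
  have hM4 : M ^ 4 = M ^ 2 * M ^ 2 := by ring
  rw [hM4]
  refine h.sortedEigenvalue_le_of_polynomials hn (prod_shiftFactor_ne_zero c hα) hp hq
    (sq_nonneg M) (fun l => ?_) fun R hR => ?_
  · rw [← sq_abs, ← sq_abs (eval _ _), ← mul_pow]
    exact pow_le_pow_left₀ (abs_nonneg _)
      (abs_eval_prod_shiftFactor_le hc hM (h.node_nonneg l)) 2
  · refine sum_coeff_sq_le_of_norm_aeval_le (Nat.zero_lt_of_lt hn) (fun z hz hzn => ?_)
      (degree_mul_lt_of_natDegree_le hn.le hp hR) (degree_mul_lt_of_natDegree_le hn.le hq hR)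
    have hzc : c ^ 2 * (1 + z.re) ≤ 2 := le_trans (by gcongr) hcn
    rw [map_mul, map_mul, norm_mul, norm_mul, ← mul_assoc]
    exact mul_le_mul_of_nonneg_right (norm_aeval_prod_shiftFactor_le hc hM hz hzc) (norm_nonneg _)

end ShiftFactor

section LogCoth

open Real

theorem hasDerivAt_tanh (x : ℝ) : HasDerivAt tanh (1 / cosh x ^ 2) x := by
  have h := (hasDerivAt_sinh x).div (hasDerivAt_cosh x) (cosh_pos x).ne'
  convert! h using 1
  · exact funext tanh_eq_sinh_div_cosh
  · rw [← cosh_sq_sub_sinh_sq x]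
    ring

theorem strictMono_tanh : StrictMono tanh :=
  strictMono_of_hasDerivAt_pos hasDerivAt_tanh fun x => by have := cosh_pos x; positivity

theorem tanh_pos {x : ℝ} (hx : 0 < x) : 0 < tanh x := tanh_zero ▸ strictMono_tanh hx

theorem tanh_le_self {x : ℝ} (hx : 0 ≤ x) : tanh x ≤ x := by
  have hmono : Monotone fun x => x - tanh x :=
    monotone_of_hasDerivAt_nonneg (fun x => (hasDerivAt_id x).sub (hasDerivAt_tanh x)) fun x =>
      sub_nonneg.2 (div_le_one_of_le₀ (one_le_pow₀ (one_le_cosh x)) (sq_nonneg _))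
  simpa using hmono hx

theorem tanh_half_eq (x : ℝ) : tanh (x / 2) = (1 - exp (-x)) / (1 + exp (-x)) := by
  have hx : exp (-x) = exp (-(x / 2)) * exp (-(x / 2)) := by rw [← exp_add]; ring_nf
  have hone : (1 : ℝ) = exp (x / 2) * exp (-(x / 2)) := by rw [← exp_add]; simp
  rw [tanh_eq, hx, hone, ← sub_mul, ← add_mul, mul_div_mul_right _ _ (exp_pos _).ne']

/-- `-log tanh (s / 2)`. -/
noncomputable def logCoth (s : ℝ) : ℝ := -log (tanh (s / 2))

/-- The integral of `logCoth` over `[s, ∞)`, as the series obtained by integrating the expansion of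
`logCoth` in powers of `exp (-s)`. -/
noncomputable def logCothTail (s : ℝ) : ℝ :=
  ∑' k : ℕ, 2 / (2 * (k : ℝ) + 1) ^ 2 * exp (-((2 * k + 1) * s))

theorem exp_neg_logCoth {s : ℝ} (hs : 0 < s) : exp (-logCoth s) = tanh (s / 2) := by
  rw [logCoth, neg_neg, exp_log (tanh_pos (half_pos hs))]

theorem hasSum_logCoth {s : ℝ} (hs : 0 < s) :
    HasSum (fun k : ℕ => 2 / (2 * (k : ℝ) + 1) * exp (-((2 * k + 1) * s))) (logCoth s) := by
  have hlt : exp (-s) < 1 := exp_lt_one_iff.2 (neg_neg_of_pos hs)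
  have h := hasSum_log_sub_log_of_abs_lt_one (x := exp (-s)) (by rwa [abs_of_pos (exp_pos _)])
  rw [logCoth, tanh_half_eq, log_div (sub_pos.2 hlt).ne' (by positivity), neg_sub]
  convert! h using 2 with k
  rw [← exp_nat_mul]
  push_cast
  rw [mul_neg]
  ring

theorem logCoth_nonneg {s : ℝ} (hs : 0 < s) : 0 ≤ logCoth s :=
  (hasSum_logCoth hs).nonneg fun k => by positivity

theorem hasDerivAt_logCoth {s : ℝ} (hs : 0 < s) : HasDerivAt logCoth (-(1 / sinh s)) s := by
  have htanh : HasDerivAt (fun s => tanh (s / 2)) (1 / cosh (s / 2) ^ 2 * (1 / 2)) s :=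
    HasDerivAt.comp (h := fun s => s / 2) s (hasDerivAt_tanh (s / 2))
      ((hasDerivAt_id' s).div_const 2)
  have hsinh : sinh s = 2 * sinh (s / 2) * cosh (s / 2) := by
    rw [← sinh_two_mul, mul_div_cancel₀ s two_ne_zero]
  convert! (htanh.log (tanh_pos (half_pos hs)).ne').neg using 1
  have := (sinh_pos_iff.2 (half_pos hs)).ne'
  rw [hsinh, tanh_eq_sinh_div_cosh]
  field_simp

theorem hasSum_odd_inv_sq : HasSum (fun k : ℕ => 2 / (2 * (k : ℝ) + 1) ^ 2) (π ^ 2 / 4) := by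
  have heven : HasSum (fun k : ℕ => (1 : ℝ) / ((2 * k : ℕ) : ℝ) ^ 2) (1 / 4 * (π ^ 2 / 6)) := by
    convert! hasSum_zeta_two.mul_left (1 / 4) using 2 with k
    push_cast
    ring
  have hodd := (hasSum_zeta_two.summable.comp_injective
    (i := fun k : ℕ => 2 * k + 1) fun a b h => by simpa using h).hasSum
  have hsplit := (HasSum.even_add_odd (f := fun n : ℕ => (1 : ℝ) / (n : ℝ) ^ 2) heven hodd).unique
    hasSum_zeta_two
  convert! hodd.mul_left 2 using 1
  · ext k
    simp [div_eq_mul_inv]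
  · linarith

theorem logCothTail_term_le {s : ℝ} (hs : 0 ≤ s) (k : ℕ) :
    2 / (2 * (k : ℝ) + 1) ^ 2 * exp (-((2 * k + 1) * s)) ≤
      2 / (2 * (k : ℝ) + 1) ^ 2 * exp (-s) := by
  refine mul_le_mul_of_nonneg_left (exp_le_exp.2 (neg_le_neg ?_)) (by positivity)
  exact le_mul_of_one_le_left hs (by linarith [(Nat.cast_nonneg k : (0 : ℝ) ≤ k)])

theorem hasSum_logCothTail {s : ℝ} (hs : 0 ≤ s) :
    HasSum (fun k : ℕ => 2 / (2 * (k : ℝ) + 1) ^ 2 * exp (-((2 * k + 1) * s)))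
      (logCothTail s) :=
  (Summable.of_nonneg_of_le (fun k => by positivity) (logCothTail_term_le hs)
    (hasSum_odd_inv_sq.summable.mul_right _)).hasSum

theorem logCothTail_zero : logCothTail 0 = π ^ 2 / 4 := by
  simp [logCothTail, hasSum_odd_inv_sq.tsum_eq]

theorem logCothTail_le {s : ℝ} (hs : 0 ≤ s) : logCothTail s ≤ π ^ 2 / 4 * exp (-s) :=
  hasSum_le (logCothTail_term_le hs) (hasSum_logCothTail hs) (hasSum_odd_inv_sq.mul_right _)

theorem continuousOn_logCothTail : ContinuousOn logCothTail (Set.Ici 0) := by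
  refine continuousOn_tsum (u := fun k : ℕ => 2 / (2 * (k : ℝ) + 1) ^ 2) (fun k => by fun_prop)
    hasSum_odd_inv_sq.summable fun k s hs => ?_
  rw [norm_of_nonneg (by positivity)]
  exact (logCothTail_term_le hs k).trans
    (mul_le_of_le_one_right (by positivity) (exp_le_one_iff.2 (neg_nonpos.2 hs)))

theorem hasDerivAt_logCothTail {s : ℝ} (hs : 0 < s) :
    HasDerivAt logCothTail (-logCoth s) s := by
  have hmem : s ∈ Set.Ioi (s / 2) := half_lt_self hs
  have h := hasDerivAt_tsum_of_isPreconnected (𝕜 := ℝ) (F := ℝ) (t := Set.Ioi (s / 2)) (y₀ := s)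
    (y := s) (u := fun k : ℕ => 2 / (2 * (k : ℝ) + 1) * exp (-((2 * k + 1) * (s / 2))))
    (g := fun (k : ℕ) s => 2 / (2 * (k : ℝ) + 1) ^ 2 * exp (-((2 * k + 1) * s)))
    (g' := fun (k : ℕ) s => -(2 / (2 * (k : ℝ) + 1) * exp (-((2 * k + 1) * s))))
    (hasSum_logCoth (half_pos hs)).summable isOpen_Ioi isPreconnected_Ioi ?_ ?_ hmem
    (hasSum_logCothTail hs.le).summable hmem
  · rw [tsum_neg, (hasSum_logCoth hs).tsum_eq] at h
    exact h
  · intro k y _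
    have hexp := ((((hasDerivAt_id y).const_mul (2 * (k : ℝ) + 1)).neg).exp).const_mul
      (2 / (2 * (k : ℝ) + 1) ^ 2)
    convert! hexp using 1
    simp only [id, Pi.neg_apply]
    field_simp
  · intro k y hy
    rw [norm_neg, norm_of_nonneg (by positivity)]
    have : s / 2 < y := hy
    gcongr

theorem logCothTail_zero_le {x : ℝ} (hx : 0 < x) :
    logCothTail 0 ≤ logCothTail x + x * logCoth x + x := by
  set ψ : ℝ → ℝ := fun s => logCothTail s + s * logCoth s + s with hψ
  have hderiv (s : ℝ) (hs : 0 < s) : HasDerivAt ψ (1 - s / sinh s) s := by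
    have h := ((hasDerivAt_logCothTail hs).add
      ((hasDerivAt_id s).mul (hasDerivAt_logCoth hs))).add (hasDerivAt_id s)
    convert! h using 1
    simp only [id]
    ring
  have hmono : MonotoneOn ψ (Set.Ioi 0) := by
    refine monotoneOn_of_hasDerivWithinAt_nonneg (convex_Ioi 0)
      (fun s hs => (hderiv s hs).continuousAt.continuousWithinAt)
      (fun s hs => (hderiv s (interior_subset hs)).hasDerivWithinAt) fun s hs => ?_
    have hs0 : 0 < s := interior_subset hs
    exact sub_nonneg.2 ((div_le_one (sinh_pos_iff.2 hs0)).2 (self_le_sinh_iff.2 hs0.le))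
  have hlim : Filter.Tendsto logCothTail (nhdsWithin 0 (Set.Ioi 0)) (nhds (logCothTail 0)) :=
    (continuousOn_logCothTail 0 Set.self_mem_Ici).mono_left
      (nhdsWithin_mono _ Set.Ioi_subset_Ici_self)
  refine le_of_tendsto hlim ?_
  filter_upwards [Ioo_mem_nhdsGT hx] with ε hε
  have hε0 := mul_nonneg hε.1.le (logCoth_nonneg hε.1)
  calc logCothTail ε ≤ ψ ε := by simp only [hψ]; linarith [hε.1]
    _ ≤ ψ x := hmono hε.1 hx hε.2.le

/-- The trapezoidal rule overestimates the integral of each (convex) term of the series. -/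
theorem logCothTail_sub_le {x δ : ℝ} (hx : 0 < x) (hδ : 0 < δ) :
    logCothTail x - logCothTail (x + δ) ≤ δ / 2 * (logCoth x + logCoth (x + δ)) := by
  refine hasSum_le (fun k => ?_)
    ((hasSum_logCothTail hx.le).sub (hasSum_logCothTail (by positivity)))
    (((hasSum_logCoth hx).add (hasSum_logCoth (by positivity))).mul_left (δ / 2))
  have hN : (0 : ℝ) < 2 * k + 1 := by positivity
  set N : ℝ := 2 * k + 1
  have htanh : 1 - exp (-(N * δ)) ≤ N * δ / 2 * (1 + exp (-(N * δ))) := by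
    have h := tanh_le_self (x := N * δ / 2) (by positivity)
    rwa [tanh_half_eq, div_le_iff₀ (by positivity)] at h
  have hexp : exp (-(N * (x + δ))) = exp (-(N * x)) * exp (-(N * δ)) := by
    rw [← exp_add]; ring_nf
  rw [hexp]
  calc _ = 2 / N ^ 2 * exp (-(N * x)) * (1 - exp (-(N * δ))) := by ring
    _ ≤ 2 / N ^ 2 * exp (-(N * x)) * (N * δ / 2 * (1 + exp (-(N * δ)))) := by gcongr
    _ = _ := by field_simp

theorem logCothTail_sub_le_sum {δ : ℝ} (hδ : 0 < δ) (k : ℕ) :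
    logCothTail (δ / 2) - logCothTail ((k + 1 / 2) * δ) +
        δ / 2 * (logCoth (δ / 2) + logCoth ((k + 1 / 2) * δ)) ≤
      δ * ∑ i ∈ Finset.range (k + 1), logCoth ((i + 1 / 2) * δ) := by
  induction k with
  | zero =>
    have hhalf : ((0 : ℕ) + 1 / 2 : ℝ) * δ = δ / 2 := by push_cast; ring
    simp only [zero_add, Finset.sum_range_one, hhalf]
    linarith
  | succ k ih =>
    have h := logCothTail_sub_le (x := (k + 1 / 2) * δ) (by positivity) hδ
    have hnext : ((k : ℝ) + 1 / 2) * δ + δ = ((k + 1 : ℕ) + 1 / 2) * δ := by push_cast; ring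
    rw [hnext] at h
    rw [Finset.sum_range_succ, mul_add]
    linarith

theorem le_mul_sum_logCoth {δ : ℝ} (hδ : 0 < δ) (k : ℕ) :
    π ^ 2 / 4 * (1 - exp (-((k + 1 / 2) * δ))) - δ / 2 ≤
      δ * ∑ i ∈ Finset.range (k + 1), logCoth ((i + 1 / 2) * δ) := by
  have hk : 0 < (k + 1 / 2) * δ := by positivity
  have hfirst := logCothTail_zero_le (half_pos hδ)
  rw [logCothTail_zero] at hfirst
  have hlast := mul_nonneg (half_pos hδ).le (logCoth_nonneg hk)
  linarith [logCothTail_sub_le_sum hδ k, logCothTail_le hk.le]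

theorem prod_tanh_le {δ : ℝ} (hδ : 0 < δ) (k : ℕ) :
    ∏ i ∈ Finset.range (k + 1), tanh ((i + 1 / 2) * δ / 2) ≤
      exp (1 / 2 - π ^ 2 / (4 * δ) * (1 - exp (-((k + 1 / 2) * δ)))) := by
  have hterm (i : ℕ) : tanh ((i + 1 / 2) * δ / 2) = exp (-logCoth ((i + 1 / 2) * δ)) :=
    (exp_neg_logCoth (by positivity)).symm
  rw [Finset.prod_congr rfl fun i _ => hterm i, ← exp_sum, Finset.sum_neg_distrib, exp_le_exp]
  have hdiv : π ^ 2 / (4 * δ) * (1 - exp (-((k + 1 / 2) * δ))) - 1 / 2 =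
      (π ^ 2 / 4 * (1 - exp (-((k + 1 / 2) * δ))) - δ / 2) / δ := by
    field_simp
  have h := (div_le_iff₀' hδ).2 (le_mul_sum_logCoth hδ k)
  linarith

end LogCoth

section NodeProduct

open Real

/-- Equidistant nodes on the logarithmic scale. -/
noncomputable def logNode (δ : ℝ) (i : ℕ) : ℝ := exp (-((i + 1 / 2) * δ))

theorem logNode_pos (δ : ℝ) (i : ℕ) : 0 < logNode δ i := exp_pos _

theorem abs_exp_sub_exp (a b : ℝ) :
    |exp (-a) - exp (-b)| = tanh (|a - b| / 2) * |exp (-a) + exp (-b)| := by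
  wlog h : a ≤ b generalizing a b
  · rw [abs_sub_comm, add_comm, this b a (le_of_not_ge h), abs_sub_comm b a]
  have hexp : exp (-b) ≤ exp (-a) := exp_le_exp.2 (neg_le_neg h)
  have hdiv : exp (-|a - b|) = exp (-b) / exp (-a) := by
    rw [abs_of_nonpos (sub_nonpos.2 h), ← exp_sub]
    ring_nf
  rw [tanh_half_eq, hdiv, abs_of_nonneg (sub_nonneg.2 hexp), abs_of_pos (by positivity)]
  field_simp

theorem exists_nat_mul_le_le_add_one_mul {δ η : ℝ} {k : ℕ} (hk : 0 < k) (hη : 0 ≤ η) (hδ : 0 < δ)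
    (hηk : η ≤ k * δ) : ∃ j < k, j * δ ≤ η ∧ η ≤ (j + 1) * δ := by
  rcases hηk.lt_or_eq with h | rfl
  · exact ⟨⌊η / δ⌋₊, (Nat.floor_lt (by positivity)).2 ((div_lt_iff₀ hδ).2 h),
      (le_div_iff₀ hδ).1 (Nat.floor_le (by positivity)),
      (div_le_iff₀ hδ).1 (Nat.lt_floor_add_one _).le⟩
  · obtain ⟨j, rfl⟩ := Nat.exists_eq_add_one.2 hk
    exact ⟨j, j.lt_succ_self, by gcongr; simp, by push_cast; rfl⟩

theorem prod_tanh_abs_sub_le {δ η : ℝ} {j k : ℕ} (hjk : j < k) (hj : j * δ ≤ η)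
    (hj' : η ≤ (j + 1) * δ) :
    ∏ i ∈ Finset.range k, tanh (|η - (i + 1 / 2) * δ| / 2) ≤
      ∏ i ∈ Finset.range k, tanh ((i + 1 / 2) * δ / 2) := by
  have hδ : 0 ≤ δ := by linarith
  have hmono {d d' : ℝ} (h : |d| ≤ d') : tanh (|d| / 2) ≤ tanh (d' / 2) :=
    strictMono_tanh.monotone (by linarith)
  have hnonneg (d : ℝ) : 0 ≤ tanh (|d| / 2) :=
    tanh_zero ▸ strictMono_tanh.monotone (by positivity)
  rw [← Finset.prod_range_mul_prod_Ico _ hjk, ← Finset.prod_range_mul_prod_Ico _ hjk,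
    ← Finset.prod_range_reflect (fun i : ℕ => tanh ((i + 1 / 2) * δ / 2))]
  refine mul_le_mul (Finset.prod_le_prod (fun i _ => hnonneg _) fun i hi => hmono ?_)
    (Finset.prod_le_prod (fun i _ => hnonneg _) fun i hi => hmono ?_)
    (Finset.prod_nonneg fun i _ => hnonneg _) (Finset.prod_nonneg fun i _ => ?_)
  · have hij : i ≤ j := Nat.le_of_lt_succ (Finset.mem_range.1 hi)
    have hijR : (i : ℝ) ≤ j := mod_cast hij
    rw [Nat.succ_sub_one, Nat.cast_sub hij, abs_le]
    constructor <;> nlinarith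
  · have hij : (j : ℝ) + 1 ≤ i := mod_cast (Finset.mem_Ico.1 hi).1
    rw [abs_le]
    constructor <;> nlinarith [j.cast_nonneg (α := ℝ)]
  · exact tanh_zero ▸ strictMono_tanh.monotone (by positivity)

theorem prod_abs_sub_logNode_le {δ y : ℝ} {k : ℕ} (hk : 0 < k) (hδ : 0 < δ)
    (hy : y ∈ Set.Icc (exp (-(k * δ))) 1) :
    ∏ i : Fin k, |y - logNode δ i| ≤
      (∏ i ∈ Finset.range k, tanh ((i + 1 / 2) * δ / 2)) * ∏ i : Fin k, |y + logNode δ i| := by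
  obtain ⟨η, rfl⟩ : ∃ η, exp (-η) = y :=
    ⟨-log y, by rw [neg_neg, exp_log ((exp_pos _).trans_le hy.1)]⟩
  obtain ⟨j, hjk, hj, hj'⟩ := exists_nat_mul_le_le_add_one_mul hk
    (neg_nonpos.1 (exp_le_one_iff.1 hy.2)) hδ (neg_le_neg_iff.1 (exp_le_exp.1 hy.1))
  simp only [logNode, abs_exp_sub_exp, Finset.prod_mul_distrib]
  rw [Fin.prod_univ_eq_prod_range (fun i => tanh (|η - (i + 1 / 2) * δ| / 2))]
  exact mul_le_mul_of_nonneg_right (prod_tanh_abs_sub_le hjk hj hj')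
    (Finset.prod_nonneg fun i _ => abs_nonneg _)

end NodeProduct

section HankelDecay

open Real

variable {n k : ℕ}

/-- Half the length of the logarithmic interval on which the shift product is estimated; it is tuned
to the angle `π / n` of the root of `z ^ n = -1` closest to `1`. -/
noncomputable def halfWidth (n : ℕ) : ℝ := log (4 * n / π)

theorem exp_neg_halfWidth (hn : 0 < n) : exp (-halfWidth n) = π / (4 * n) := by
  rw [halfWidth, exp_neg, exp_log (by positivity), inv_div]

theorem three_halves_le_halfWidth (hn : 5 ≤ n) : 3 / 2 ≤ halfWidth n := by
  have hn' : (5 : ℝ) ≤ n := mod_cast hn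
  have hexp : exp (3 / 2) ≤ 5 := by
    have hsq : exp (3 / 2) ^ 2 = exp 1 ^ 3 := by
      rw [← exp_nat_mul, ← exp_nat_mul]
      norm_num
    refine (sq_le_sq₀ (exp_pos _).le (by norm_num)).1 (hsq.trans_le ?_)
    calc exp 1 ^ 3 ≤ 2.72 ^ 3 := by
          gcongr
          exact exp_one_lt_d9.le.trans (by norm_num)
      _ ≤ 5 ^ 2 := by norm_num
  rw [halfWidth, le_log_iff_exp_le (by positivity), le_div_iff₀ pi_pos]
  nlinarith [pi_lt_d2, pi_pos]

/-- With `δ = 2 * halfWidth n / k`, the truncation error of the product estimate. -/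
theorem truncation_error_le (hk : 2 ≤ k) (hkn : 2 * k ≤ n) (hn : 5 ≤ n) :
    k * π ^ 2 / (8 * halfWidth n) * exp (-(2 * halfWidth n - halfWidth n / k)) ≤ 0.15 := by
  have hkR : (2 : ℝ) ≤ k := mod_cast hk
  have hknR : 2 * (k : ℝ) ≤ n := mod_cast hkn
  have hn' : (5 : ℝ) ≤ n := mod_cast hn
  have hh := three_halves_le_halfWidth hn
  have hx := exp_neg_halfWidth (n := n) (by omega)
  set h := halfWidth n
  have hπ : π < 3.15 := pi_lt_d2
  have hhalf : exp (-(h / 2)) ≤ 2 / 5 := by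
    refine (sq_le_sq₀ (exp_pos _).le (by norm_num)).1 ?_
    rw [← exp_nat_mul, Nat.cast_two, mul_neg, mul_div_cancel₀ h two_ne_zero, hx,
      div_le_iff₀ (by positivity)]
    linarith
  have hexp : exp (-(2 * h - h / k)) ≤ π / (4 * n) * (2 / 5) := by
    have hhk : h / k ≤ h / 2 := div_le_div_of_nonneg_left (by linarith) two_pos hkR
    calc exp (-(2 * h - h / k)) ≤ exp (-h + -(h / 2)) := exp_le_exp.2 (by linarith)
      _ = π / (4 * n) * exp (-(h / 2)) := by rw [exp_add, hx]
      _ ≤ π / (4 * n) * (2 / 5) := by gcongr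
  have hhn : 3 / 2 * (2 * (k : ℝ)) ≤ h * n := by gcongr
  calc k * π ^ 2 / (8 * h) * exp (-(2 * h - h / k))
      ≤ k * π ^ 2 / (8 * h) * (π / (4 * n) * (2 / 5)) := by gcongr
    _ = k * π ^ 3 / (80 * (h * n)) := by field_simp; norm_num
    _ ≤ k * 3.15 ^ 3 / (80 * (3 / 2 * (2 * k))) := by gcongr
    _ ≤ 0.15 := by field_simp; norm_num

theorem prod_tanh_le_two_mul_exp (hk : 2 ≤ k) (hkn : 2 * k ≤ n) (hn : 5 ≤ n) :
    ∏ i ∈ Finset.range k, tanh ((i + 1 / 2) * (2 * halfWidth n / k) / 2) ≤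
      2 * exp (-(k * π ^ 2 / (8 * halfWidth n))) := by
  have hh : 0 < halfWidth n := by linarith [three_halves_le_halfWidth hn]
  have htrunc := truncation_error_le hk hkn hn
  set h := halfWidth n
  obtain ⟨k, rfl⟩ := Nat.exists_eq_add_one.2 (zero_lt_two.trans_le hk)
  have hlast : (k + 1 / 2) * (2 * h / (k + 1 : ℕ)) = 2 * h - h / (k + 1 : ℕ) := by
    push_cast
    field_simp
    ring
  have hrate : π ^ 2 / (4 * (2 * h / (k + 1 : ℕ))) = (k + 1 : ℕ) * π ^ 2 / (8 * h) := by
    field_simp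
    norm_num
  refine (prod_tanh_le (by positivity) k).trans ?_
  rw [hlast, hrate]
  calc _ ≤ exp (log 2 + -((k + 1 : ℕ) * π ^ 2 / (8 * h))) :=
        exp_le_exp.2 (by linarith [log_two_gt_d9])
    _ = _ := by rw [exp_add, exp_log two_pos]

theorem cos_pi_div_two_mul_le_tanh_halfWidth (hn : 5 ≤ n) :
    cos (π / (2 * n)) ≤ tanh (halfWidth n) := by
  have hn' : (5 : ℝ) ≤ n := mod_cast hn
  have hexp : exp (-(2 * halfWidth n)) = (π / (2 * n)) ^ 2 / 4 := by
    rw [two_mul, neg_add, exp_add, exp_neg_halfWidth (by omega)]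
    field_simp
    norm_num
  have htanh := tanh_half_eq (2 * halfWidth n)
  rw [mul_div_cancel_left₀ _ two_ne_zero, hexp] at htanh
  have hx : π / (2 * n) ≤ 1 / 2 := by
    rw [div_le_iff₀ (by positivity)]
    linarith [pi_lt_d2]
  have hx0 : 0 < π / (2 * n) := by positivity
  rw [htanh, le_div_iff₀ (by positivity)]
  set x := π / (2 * n)
  have hcos := (abs_le.1 (cos_bound (x := x) (by rw [abs_of_pos hx0]; linarith))).2
  rw [abs_of_pos hx0] at hcos
  have hx2 : x ^ 2 ≤ 1 / 4 := by nlinarith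
  nlinarith [mul_le_mul_of_nonneg_right hcos (show 0 ≤ 1 + x ^ 2 / 4 by positivity),
    mul_nonneg (sq_nonneg (x ^ 2)) (sub_nonneg.2 hx2), sq_nonneg (x ^ 2)]

theorem inv_tanh_halfWidth_separation (hn : 5 ≤ n) :
    (tanh (halfWidth n))⁻¹ ^ 2 * (1 + cos (π / n)) ≤ 2 := by
  have hn' : (5 : ℝ) ≤ n := mod_cast hn
  have hpos : 0 < tanh (halfWidth n) := tanh_pos (by linarith [three_halves_le_halfWidth hn])
  have hdouble : π / n = 2 * (π / (2 * n)) := by field_simp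
  have hcos : 0 ≤ cos (π / (2 * n)) := by
    refine cos_nonneg_of_mem_Icc ⟨by linarith [show 0 < π / (2 * n) by positivity, pi_pos], ?_⟩
    gcongr
    linarith
  rw [hdouble, cos_two_mul, inv_pow, inv_mul_le_iff₀ (by positivity)]
  nlinarith [pow_le_pow_left₀ hcos (cos_pi_div_two_mul_le_tanh_halfWidth hn) 2]

theorem sub_one_div_log_le_div_halfWidth (hk : 2 ≤ k) (hkn : 2 * k < n) :
    ((k : ℝ) - 1) / log (8 * (n / 2 : ℕ) / π) ≤ k / halfWidth n := by
  have hn : 5 ≤ n := by omega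
  have hnR : (5 : ℝ) ≤ n := mod_cast hn
  have hkR : (2 : ℝ) ≤ k := mod_cast hk
  have hknR : 2 * (k : ℝ) + 1 ≤ n := mod_cast hkn
  have hh := three_halves_le_halfWidth hn
  have hfloor : (n : ℝ) - 1 ≤ 2 * (n / 2 : ℕ) := by
    have : n ≤ 2 * (n / 2) + 1 := by omega
    rw [sub_le_iff_le_add]
    exact_mod_cast this
  have hlog : halfWidth n ≤ log (8 * (n / 2 : ℕ) / π) + 1 / (2 * k) := by
    have hn1 : (0 : ℝ) < n - 1 := by linarith
    calc halfWidth n = log (4 * (n - 1) / π) + log (n / (n - 1)) := by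
          rw [halfWidth, ← log_mul (by positivity) (by positivity)]
          congr 1
          field_simp
      _ ≤ log (8 * (n / 2 : ℕ) / π) + (n / (n - 1) - 1) := by
          refine add_le_add (log_le_log (by positivity) ?_)
            (log_le_sub_one_of_pos (by positivity))
          gcongr ?_ / _
          linarith
      _ ≤ _ := by
          rw [div_sub_one hn1.ne', sub_sub_cancel]
          gcongr
          linarith
  have hk4 : (1 : ℝ) / (2 * k) ≤ 1 / 4 := by
    gcongr
    linarith
  have hcancel : (k : ℝ) * (1 / (2 * k)) = 1 / 2 := by field_simp
  rw [div_le_div_iff₀ (by linarith) (by linarith)]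
  nlinarith

/-- The rate of decay in the spectral bound for positive definite Hankel matrices. It is `1` for
`n ≤ 1`, because `log 0 = 0` and `x / 0 = 0`. -/
noncomputable def hankelRate (n : ℕ) : ℝ := exp (π ^ 2 / (4 * log (8 * (n / 2 : ℕ) / π)))

theorem one_le_hankelRate (n : ℕ) : 1 ≤ hankelRate n := by
  have hlog : 0 ≤ log (8 * (n / 2 : ℕ) / π) := by
    rcases Nat.eq_zero_or_pos (n / 2) with h | h
    · simp [h]
    · have h1 : (1 : ℝ) ≤ (n / 2 : ℕ) := mod_cast h
      exact log_nonneg ((one_le_div pi_pos).2 (by linarith [pi_le_four]))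
  exact one_le_exp (by positivity)

theorem two_mul_exp_pow_four_le (hk : 2 ≤ k) (hkn : 2 * k < n) :
    (2 * exp (-(k * π ^ 2 / (8 * halfWidth n)))) ^ 4 ≤
      16 * hankelRate n ^ (-2 * (k : ℤ) + 2) := by
  have h := mul_le_mul_of_nonneg_left (sub_one_div_log_le_div_halfWidth hk hkn)
    (show 0 ≤ π ^ 2 / 2 by positivity)
  rw [mul_pow, hankelRate, ← exp_nat_mul, ← rpow_intCast, ← exp_mul]
  refine mul_le_mul (by norm_num) (exp_le_exp.2 ?_) (exp_pos _).le (by norm_num)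
  calc ((4 : ℕ) : ℝ) * -(k * π ^ 2 / (8 * halfWidth n)) = -(π ^ 2 / 2 * (k / halfWidth n)) := by
        push_cast; ring
    _ ≤ -(π ^ 2 / 2 * ((k - 1) / log (8 * (n / 2 : ℕ) / π))) := neg_le_neg h
    _ = _ := by push_cast; ring

theorem IsMomentMatrix.sortedEigenvalue_two_mul_le {κ : Type*} [Fintype κ]
    {K : Matrix (Fin n) (Fin n) ℝ} {w θ : κ → ℝ} (hK : IsMomentMatrix K w θ) (hk : 2 * k < n) :
    sortedEigenvalue hK.isHermitian ⟨2 * k, hk⟩ ≤ 16 * hankelRate n ^ (-2 * (k : ℤ) + 2) *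
      sortedEigenvalue hK.isHermitian ⟨0, Nat.zero_lt_of_lt hk⟩ := by
  have h0 := hK.sortedEigenvalue_zero_nonneg (Nat.zero_lt_of_lt hk)
  rcases lt_or_ge k 2 with hk2 | hk2
  · refine (sortedEigenvalue_antitone hK.isHermitian
      (Fin.mk_le_mk.2 (Nat.zero_le _))).trans
      (le_mul_of_one_le_left h0 ?_)
    linarith [one_le_zpow₀ (one_le_hankelRate n) (n := -2 * (k : ℤ) + 2) (by omega)]
  have hn : 5 ≤ n := by omega
  have hh : 0 < halfWidth n := by linarith [three_halves_le_halfWidth hn]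
  have htanh : 0 < tanh (halfWidth n) := tanh_pos hh
  have hinterval : ((tanh (halfWidth n))⁻¹ - 1) / ((tanh (halfWidth n))⁻¹ + 1) =
      exp (-(k * (2 * halfWidth n / k))) := by
    have h := tanh_half_eq (2 * halfWidth n)
    rw [mul_div_cancel_left₀ _ two_ne_zero] at h
    have hlt : exp (-(2 * halfWidth n)) < 1 := exp_lt_one_iff.2 (by linarith)
    have hsub : 0 < 1 - exp (-(2 * halfWidth n)) := sub_pos.2 hlt
    rw [h, mul_div_cancel₀ _ (by positivity), inv_div]
    field_simp
    ring
  have key := hK.sortedEigenvalue_le_of_shifts (ι := Fin k)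
    (α := fun i => logNode (2 * halfWidth n / k) i) (c := (tanh (halfWidth n))⁻¹)
    (M := 2 * exp (-(k * π ^ 2 / (8 * halfWidth n)))) (by simpa using hk)
    (fun i => logNode_pos _ _) ((one_lt_inv₀ htanh).2 (tanh_lt_one _))
    (fun y hy => (prod_abs_sub_logNode_le (by omega) (by positivity) (hinterval ▸ hy)).trans
      (mul_le_mul_of_nonneg_right (prod_tanh_le_two_mul_exp hk2 hk.le hn) (by positivity)))
    (inv_tanh_halfWidth_separation hn)
  simp only [Fintype.card_fin] at key
  exact key.trans (mul_le_mul_of_nonneg_right (two_mul_exp_pow_four_le hk2 hk) h0)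

end HankelDecay

section SmallestEigenvalue

open Polynomial

variable {ι : Type*} [Fintype ι] {n : ℕ} {K : Matrix (Fin n) (Fin n) ℝ} {w θ : ι → ℝ}

theorem IsMomentMatrix.sortedEigenvalue_last_le_of_outliers (hK : IsMomentMatrix K w θ)
    (hn : 0 < n) {q L : ℝ} (S : Finset ι) (hS : S.card < n) (hq : ∀ l ∉ S, θ l ≤ q)
    (hL : ∀ l, θ l ≤ L) :
    sortedEigenvalue hK.isHermitian ⟨n - 1, Nat.sub_one_lt_of_lt hn⟩ ≤
      (q ^ (n - 1 - S.card) * L ^ S.card) ^ 2 * ∑ l, w l := by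
  have hprod : (∏ l ∈ S, (X - C (θ l))).Monic := monic_prod_of_monic _ _ fun l _ => monic_X_sub_C _
  refine hK.sortedEigenvalue_last_le_of_monic hn
    (P := X ^ (n - 1 - S.card) * ∏ l ∈ S, (X - C (θ l))) ((monic_X_pow _).mul hprod) ?_ fun l => ?_
  · rw [(monic_X_pow _).natDegree_mul hprod, natDegree_X_pow, natDegree_finsetProd_X_sub_C_eq_card]
    omega
  rw [eval_mul, eval_pow, eval_X, eval_prod]
  by_cases hl : l ∈ S
  · rw [Finset.prod_eq_zero hl (by simp), mul_zero, zero_pow two_ne_zero]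
    positivity
  have hθ := hK.node_nonneg
  have hdiff : |∏ m ∈ S, (X - C (θ m)).eval (θ l)| ≤ L ^ S.card := by
    rw [Finset.abs_prod, ← Finset.prod_const]
    refine Finset.prod_le_prod (fun _ _ => abs_nonneg _) fun m _ => ?_
    rw [eval_sub, eval_X, eval_C]
    exact abs_sub_le_of_nonneg_of_le (hθ l) (hL l) (hθ m) (hL m)
  rw [← sq_abs, abs_mul, abs_of_nonneg (pow_nonneg (hθ l) _)]
  have hpow := pow_le_pow_left₀ (hθ l) (hq l hl) (n - 1 - S.card)
  have hl0 := hθ l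
  have hq0 := (pow_nonneg (hθ l) (n - 1 - S.card)).trans hpow
  gcongr

theorem IsMomentMatrix.sortedEigenvalue_last_le_exp (hK : IsMomentMatrix K w θ) (hn : 0 < n)
    {κ L : ℝ} {m : ℕ} (hκ : 0 ≤ κ) (hL : 1 ≤ L) (hθL : ∀ l, θ l ≤ L)
    (hm : {l | Real.exp (-(κ / 4)) < θ l}.ncard ≤ m) :
    sortedEigenvalue hK.isHermitian ⟨n - 1, Nat.sub_one_lt_of_lt hn⟩ ≤
      Real.exp (κ * (m + 2) / 2) * L ^ (2 * m) * Real.exp (-(κ * ((n : ℝ) + 1) / 2)) *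
        ∑ l, w l := by
  classical
  set S := Finset.univ.filter fun l => Real.exp (-(κ / 4)) < θ l with hSdef
  rw [Set.ncard_eq_toFinset_card', Set.toFinset_ofPred] at hm
  have hw : 0 ≤ ∑ l, w l := Finset.sum_nonneg fun l _ => hK.weight_nonneg l
  have hexp : Real.exp (κ * (m + 2) / 2) * L ^ (2 * m) * Real.exp (-(κ * ((n : ℝ) + 1) / 2)) =
      Real.exp (κ * (m + 1 - n) / 2) * L ^ (2 * m) := by
    rw [mul_right_comm, ← Real.exp_add]
    ring_nf
  rw [hexp]
  rcases lt_or_ge S.card n with hS | hS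
  · have hpow : Real.exp (-(κ / 4)) ^ (n - 1 - S.card) = Real.exp (κ * (S.card + 1 - n) / 4) := by
      rw [← Real.exp_nat_mul, Nat.sub_sub, Nat.cast_sub (by omega)]
      push_cast
      ring_nf
    refine (hK.sortedEigenvalue_last_le_of_outliers hn (q := Real.exp (-(κ / 4))) S hS
      (by simp [hSdef]) hθL).trans ?_
    rw [mul_pow, hpow, ← Real.exp_nat_mul, ← pow_mul, mul_comm S.card 2]
    gcongr
    push_cast
    have hSm : (S.card : ℝ) ≤ m := mod_cast hm
    nlinarith
  · refine (hK.sortedEigenvalue_last_le_of_monic hn (B := 1) monic_one (by simpa using hn)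
      (by simp)).trans (mul_le_mul_of_nonneg_right ?_ hw)
    have hnm : (n : ℝ) ≤ m := mod_cast hS.trans hm
    exact one_le_mul_of_one_le_of_one_le
      (Real.one_le_exp (div_nonneg (mul_nonneg hκ (by linarith)) two_pos.le)) (one_le_pow₀ hL)

end SmallestEigenvalue

section Diagonalization

open Module

variable {V H F : Type*} [AddCommGroup V] [Module ℝ V] [NormedAddCommGroup H]
  [InnerProductSpace ℝ H] [NormedAddCommGroup F] [InnerProductSpace ℝ F]
  {ι : Type*} [DecidableEq ι] {G : V →ₗ[ℝ] H} {J : V →ₗ[ℝ] F} {b : Basis ι ℝ V} {μ : ι → ℝ}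

/-- The basis `b` diagonalizes the quadratic form `‖J v‖ ^ 2` with respect to the quadratic form
`‖G v‖ ^ 2`, with generalized eigenvalues `μ l`. -/
structure Diagonalizes (G : V →ₗ[ℝ] H) (J : V →ₗ[ℝ] F) (b : Basis ι ℝ V) (μ : ι → ℝ) : Prop where
  orthonormal : Orthonormal ℝ fun l => G (b l)
  inner_apply : ∀ l m, inner ℝ (J (b l)) (J (b m)) = if l = m then μ l else 0

theorem exists_diagonalizes [FiniteDimensional ℝ V] [CompleteSpace F] (J : V →ₗ[ℝ] F)
    (hG : Function.Injective G) :
    ∃ (b : Basis (Fin (finrank ℝ V)) ℝ V) (μ : Fin (finrank ℝ V) → ℝ), Diagonalizes G J b μ := by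
  let E := LinearEquiv.ofInjective G hG
  have hE : ∀ x, G (E.symm x) = x := fun x => congrArg Subtype.val (E.apply_symm_apply x)
  let T : LinearMap.range G →L[ℝ] F := (J ∘ₗ E.symm.toLinearMap).toContinuousLinearMap
  have hT : (T.adjoint ∘L T : LinearMap.range G →ₗ[ℝ] LinearMap.range G).IsSymmetric := by
    intro x y
    simp [ContinuousLinearMap.adjoint_inner_left, ContinuousLinearMap.adjoint_inner_right]
  let e := hT.eigenvectorBasis E.finrank_eq.symm
  let μ := hT.eigenvalues E.finrank_eq.symm
  have hTe : ∀ l, T.adjoint (T (e l)) = μ l • e l := fun l => hT.apply_eigenvectorBasis _ l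
  refine ⟨e.toBasis.map E.symm, μ, ?_, fun l m => ?_⟩
  · simpa [hE, Function.comp_def] using
      e.orthonormal.comp_linearIsometry (LinearMap.range G).subtypeₗᵢ
  · calc inner ℝ (J ((e.toBasis.map E.symm) l)) (J ((e.toBasis.map E.symm) m))
        = inner ℝ (T (e l)) (T (e m)) := by simp [T]
      _ = inner ℝ (T.adjoint (T (e l))) (e m) := (T.adjoint_inner_left _ _).symm
      _ = if l = m then μ l else 0 := by
        rw [hTe, inner_smul_left, orthonormal_iff_ite.1 e.orthonormal]
        simp

namespace Diagonalizes

theorem eigenvalue_eq (h : Diagonalizes G J b μ) (l : ι) : μ l = ‖J (b l)‖ ^ 2 := by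
  rw [← real_inner_self_eq_norm_sq, h.inner_apply, if_pos rfl]

theorem norm_apply_basis (h : Diagonalizes G J b μ) (l : ι) : ‖G (b l)‖ = 1 := h.orthonormal.1 l

theorem eigenvalue_le (h : Diagonalizes G J b μ) {C : ℝ} (hC : ∀ v, ‖J v‖ ≤ C * ‖G v‖) (l : ι) :
    μ l ≤ C ^ 2 := by
  have hl := hC (b l)
  rw [h.norm_apply_basis, mul_one] at hl
  exact h.eigenvalue_eq l ▸ pow_le_pow_left₀ (norm_nonneg _) hl 2

theorem inner_apply_basis [Finite ι] (h : Diagonalizes G J b μ) (v : V) (l : ι) :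
    inner ℝ (G v) (G (b l)) = b.repr v l := by
  cases nonempty_fintype ι
  conv_lhs => rw [← b.sum_repr v]
  simp only [map_sum, map_smul]
  exact h.orthonormal.inner_left_fintype _ l

theorem inner_image_basis [Finite ι] (h : Diagonalizes G J b μ) (v : V) (l : ι) :
    inner ℝ (J v) (J (b l)) = μ l * b.repr v l := by
  cases nonempty_fintype ι
  conv_lhs => rw [← b.sum_repr v]
  simp only [map_sum, map_smul, sum_inner, inner_smul_left, h.inner_apply]
  simp [mul_comm]

section Fintype

variable [Fintype ι]

theorem inner_apply_eq_sum (h : Diagonalizes G J b μ) (v w : V) :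
    inner ℝ (G v) (G w) = ∑ l, b.repr v l * b.repr w l := by
  conv_lhs => rw [← b.sum_repr w]
  simp only [map_sum, map_smul, inner_sum, inner_smul_right, h.inner_apply_basis, mul_comm]

theorem norm_apply_sq (h : Diagonalizes G J b μ) (v : V) :
    ‖G v‖ ^ 2 = ∑ l, b.repr v l ^ 2 := by
  rw [← real_inner_self_eq_norm_sq, h.inner_apply_eq_sum]
  simp only [sq]

theorem norm_image_sq (h : Diagonalizes G J b μ) (v : V) :
    ‖J v‖ ^ 2 = ∑ l, μ l * b.repr v l ^ 2 := by
  rw [← real_inner_self_eq_norm_sq]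
  nth_rewrite 2 [← b.sum_repr v]
  simp only [map_sum, map_smul, inner_sum, inner_smul_right, h.inner_image_basis]
  exact Finset.sum_congr rfl fun l _ => by ring

-- The recursion says that `x` is a Krylov sequence of the operator `S` with
-- `ν (G (S v), G w) = (J v, J w)`, whose eigenvalues are the nodes.
theorem isMomentMatrix (h : Diagonalizes G J b μ) {ν : ℝ} (hν : 0 < ν) {n : ℕ} (hn : 0 < n)
    {x : Fin n → V} (hx : ∀ i j : Fin n, (j : ℕ) = i + 1 →
      ∀ v, ν * inner ℝ (G (x j)) (G v) = inner ℝ (J (x i)) (J v)) :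
    IsMomentMatrix (ν • Matrix.gram ℝ fun i => G (x i))
      (fun l => ν * b.repr (x ⟨0, hn⟩) l ^ 2) fun l => μ l / ν where
  weight_nonneg l := by positivity
  node_nonneg l := div_nonneg (h.eigenvalue_eq l ▸ sq_nonneg _) hν.le
  apply_eq := by
    have hcoef : ∀ (i : ℕ) (hi : i < n) (l : ι),
        b.repr (x ⟨i, hi⟩) l = (μ l / ν) ^ i * b.repr (x ⟨0, hn⟩) l := by
      intro i
      induction i with
      | zero => simp
      | succ i ih =>
        intro hi l
        have hstep := hx ⟨i, by lia⟩ ⟨i + 1, hi⟩ rfl (b l)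
        rw [h.inner_apply_basis, h.inner_image_basis, ih] at hstep
        rw [eq_div_of_mul_eq hν.ne' ((mul_comm _ _).trans hstep)]
        ring
    intro i j
    rw [Matrix.smul_apply, Matrix.gram_apply, smul_eq_mul, h.inner_apply_eq_sum, Finset.mul_sum]
    refine Finset.sum_congr rfl fun l _ => ?_
    rw [hcoef i i.2, hcoef j j.2]
    ring

end Fintype

theorem ncard_eigenvalue_le [Finite ι] {F' : Type*} [NormedAddCommGroup F'] [NormedSpace ℝ F']
    [FiniteDimensional ℝ F'] (h : Diagonalizes G J b μ) {ε : ℝ} (P : F →ₗ[ℝ] F')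
    (hP : ∀ v, P (J v) = 0 → ‖J v‖ ≤ ε * ‖G v‖) :
    {l | ε ^ 2 < μ l}.ncard ≤ finrank ℝ F' := by
  cases nonempty_fintype ι
  by_contra! hlt
  set S : Set ι := {l | ε ^ 2 < μ l}
  obtain ⟨c, hc, hc0⟩ : ∃ c ∈ LinearMap.ker
      (P ∘ₗ J ∘ₗ b.equivFun.symm.toLinearMap ∘ₗ
        Function.ExtendByZero.linearMap ℝ (Subtype.val : S → ι)), c ≠ 0 := by
    refine Submodule.exists_mem_ne_zero_of_ne_bot (LinearMap.ker_ne_bot_of_finrank_lt ?_)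
    rwa [finrank_fintype_fun_eq_card, ← Nat.card_eq_fintype_card, Nat.card_coe_set_eq]
  set v := b.equivFun.symm (Function.ExtendByZero.linearMap ℝ (Subtype.val : S → ι) c)
  have hrepr : ∀ l, b.repr v l = Function.extend (Subtype.val : S → ι) c 0 l := fun l =>
    congrFun (b.equivFun.apply_symm_apply _) l
  have hin : ∀ l : S, b.repr v l = c l := fun l =>
    (hrepr l).trans (Subtype.val_injective.extend_apply c 0 l)
  have hout : ∀ l ∉ S, b.repr v l = 0 := fun l hl =>
    (hrepr l).trans (Function.extend_apply' _ _ _ (by rintro ⟨l', rfl⟩; exact hl l'.2))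
  obtain ⟨l₀, hl₀⟩ := Function.ne_iff.1 hc0
  refine (pow_le_pow_left₀ (norm_nonneg _) (hP v hc) 2).not_gt ?_
  rw [mul_pow, h.norm_apply_sq, h.norm_image_sq, Finset.mul_sum]
  refine Finset.sum_lt_sum (fun l _ => ?_) ⟨l₀, Finset.mem_univ _, ?_⟩
  · by_cases hl : l ∈ S
    · exact mul_le_mul_of_nonneg_right (le_of_lt hl) (sq_nonneg _)
    · simp [hout l hl]
  · rw [hin]
    exact mul_lt_mul_of_pos_right l₀.2 (sq_pos_of_ne_zero hl₀)

end Diagonalizes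

end Diagonalization

section Translation

variable {α : Type*} [MeasurableSpace α] {μ : Measure α} {E F : Type*} [NormedAddCommGroup E]
  [NormedSpace ℝ E] [NormedAddCommGroup F] [NormedSpace ℝ F]

theorem enorm_integral_sq_le [IsProbabilityMeasure μ] {f : α → F}
    (hf : AEStronglyMeasurable f μ) : ‖∫ x, f x ∂μ‖ₑ ^ 2 ≤ ∫⁻ x, ‖f x‖ₑ ^ 2 ∂μ :=
  calc ‖∫ x, f x ∂μ‖ₑ ^ 2 ≤ eLpNorm f 1 μ ^ 2 := by
        rw [eLpNorm_one_eq_lintegral_enorm]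
        gcongr
        exact enorm_integral_le_lintegral_enorm f
    _ ≤ eLpNorm f 2 μ ^ 2 := by
        gcongr
        exact eLpNorm_le_eLpNorm_of_exponent_le one_le_two hf
    _ = ∫⁻ x, ‖f x‖ₑ ^ 2 ∂μ := by
        simpa using eLpNorm_nnreal_pow_eq_lintegral (f := f) (p := 2) (μ := μ) two_ne_zero

theorem enorm_sub_average_sq_le [CompleteSpace F] [IsFiniteMeasure μ] [NeZero μ] {f : α → F}
    (hf : Integrable f μ) (c : F) : ‖c - ⨍ x, f x ∂μ‖ₑ ^ 2 ≤ ⨍⁻ x, ‖c - f x‖ₑ ^ 2 ∂μ := by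
  have hsub : c - ⨍ x, f x ∂μ = ⨍ x, (c - f x) ∂μ := by
    rw [average, average, integral_sub (integrable_const c) hf.to_average, integral_const]
    simp
  rw [hsub]
  exact enorm_integral_sq_le ((integrable_const c).sub hf).to_average.aestronglyMeasurable

variable [CompleteSpace F] {φ : E → F}

theorem sub_eq_integral_fderiv (hφ : ContDiff ℝ 1 φ) (x h : E) :
    φ (x + h) - φ x = ∫ t in Set.Icc (0 : ℝ) 1, fderiv ℝ φ (x + t • h) h := by
  have hline : ∀ t : ℝ, HasDerivAt (fun t : ℝ => φ (x + t • h)) (fderiv ℝ φ (x + t • h) h) t :=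
    fun t => ((hφ.differentiable one_ne_zero _).hasFDerivAt.comp_hasDerivAt t
      (((hasDerivAt_id t).smul_const h).const_add x)).congr_deriv (by simp)
  have hcont : Continuous fun t : ℝ => fderiv ℝ φ (x + t • h) h :=
    ((hφ.continuous_fderiv one_ne_zero).comp (by fun_prop)).clm_apply continuous_const
  rw [integral_Icc_eq_integral_Ioc, ← intervalIntegral.integral_of_le zero_le_one,
    intervalIntegral.integral_eq_sub_of_hasDerivAt (fun t _ => hline t)
      (hcont.intervalIntegrable _ _)]
  simp

theorem enorm_sub_sq_le_lintegral_fderiv (hφ : ContDiff ℝ 1 φ) (x h : E) :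
    ‖φ (x + h) - φ x‖ₑ ^ 2 ≤
      ‖h‖ₑ ^ 2 * ∫⁻ t in Set.Icc (0 : ℝ) 1, ‖fderiv ℝ φ (x + t • h)‖ₑ ^ 2 := by
  have hcont : Continuous fun t : ℝ => fderiv ℝ φ (x + t • h) :=
    (hφ.continuous_fderiv one_ne_zero).comp (by fun_prop)
  have : IsProbabilityMeasure (volume.restrict (Set.Icc (0 : ℝ) 1)) := ⟨by simp⟩
  rw [sub_eq_integral_fderiv hφ, ← lintegral_const_mul' _ _ (by simp)]
  refine (enorm_integral_sq_le (hcont.clm_apply continuous_const).aestronglyMeasurable).trans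
    (lintegral_mono fun t => ?_)
  rw [← mul_pow, mul_comm]
  gcongr
  exact ContinuousLinearMap.le_opENorm _ _

theorem lintegral_enorm_translate_sub_sq_le [FiniteDimensional ℝ E] [MeasurableSpace E]
    [BorelSpace E] (μ : Measure E) [μ.IsAddHaarMeasure] (hφ : ContDiff ℝ 1 φ) (h : E) :
    ∫⁻ x, ‖φ (x + h) - φ x‖ₑ ^ 2 ∂μ ≤ ‖h‖ₑ ^ 2 * ∫⁻ x, ‖fderiv ℝ φ x‖ₑ ^ 2 ∂μ := by
  have hD : Continuous fun z : E × ℝ => fderiv ℝ φ (z.1 + z.2 • h) :=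
    (hφ.continuous_fderiv one_ne_zero).comp (by fun_prop)
  calc ∫⁻ x, ‖φ (x + h) - φ x‖ₑ ^ 2 ∂μ
      ≤ ∫⁻ x, ‖h‖ₑ ^ 2 * (∫⁻ t in Set.Icc (0 : ℝ) 1, ‖fderiv ℝ φ (x + t • h)‖ₑ ^ 2) ∂μ :=
        lintegral_mono fun x => enorm_sub_sq_le_lintegral_fderiv hφ x h
    _ = ‖h‖ₑ ^ 2 * ∫⁻ t in Set.Icc (0 : ℝ) 1, (∫⁻ x, ‖fderiv ℝ φ (x + t • h)‖ₑ ^ 2 ∂μ) := by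
        rw [lintegral_const_mul' _ _ (by simp),
          lintegral_lintegral_swap (hD.enorm.measurable.pow_const 2).aemeasurable]
    _ = ‖h‖ₑ ^ 2 * ∫⁻ x, ‖fderiv ℝ φ x‖ₑ ^ 2 ∂μ := by
        simp only [lintegral_add_right_eq_self fun x => ‖fderiv ℝ φ x‖ₑ ^ 2]
        simp

end Translation

section StepApproximation

theorem exists_simpleFunc_dist_lt {X : Type*} [PseudoMetricSpace X] [ProperSpace X]
    [MeasurableSpace X] [OpensMeasurableSpace X] [Nonempty X] {S : Set X}
    (hS : Bornology.IsBounded S) {ε : ℝ} (hε : 0 < ε) :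
    ∃ σ : SimpleFunc X X, ∀ x ∈ S, dist (σ x) x < ε := by
  let e := TopologicalSpace.denseSeq X
  obtain ⟨t, ht⟩ := hS.isCompact_closure.elim_finite_subcover (fun k => Metric.ball (e k) ε)
    (fun _ => Metric.isOpen_ball) fun x _ => by
      obtain ⟨k, hk⟩ := (TopologicalSpace.denseRange_denseSeq X).exists_dist_lt x hε
      exact Set.mem_iUnion.2 ⟨k, hk⟩
  refine ⟨SimpleFunc.nearestPt e (t.sup id), fun x hx => ?_⟩
  obtain ⟨k, hk, hxk⟩ := Set.mem_iUnion₂.1 (ht (subset_closure hx))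
  rw [Metric.mem_ball, dist_comm] at hxk
  have hle := SimpleFunc.edist_nearestPt_le e x (Finset.le_sup (f := id) hk)
  rw [edist_dist, edist_dist] at hle
  exact ((ENNReal.ofReal_le_ofReal_iff dist_nonneg).1 hle).trans_lt hxk

section Lp

variable {α κ F : Type*} [MeasurableSpace α] {μ : Measure α} [IsFiniteMeasure μ]
  [Finite κ] [MeasurableSpace κ] [MeasurableSingletonClass κ] [NormedAddCommGroup F]

theorem memLp_comp_of_finite {σ : α → κ} (hσ : Measurable σ) (c : κ → F) :
    MemLp (fun x => c (σ x)) 2 μ := by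
  have := Fintype.ofFinite κ
  exact .of_bound
    ((StronglyMeasurable.of_discrete (f := c)).comp_measurable hσ).aestronglyMeasurable
    ‖c‖ (.of_forall fun x => norm_le_pi_norm c (σ x))

/-- The function `x ↦ c (σ x)`, constant on the fibres of `σ`, as an element of `L²`. -/
noncomputable def stepLp [NormedSpace ℝ F] (μ : Measure α) [IsFiniteMeasure μ] {σ : α → κ}
    (hσ : Measurable σ) : (κ → F) →ₗ[ℝ] Lp F 2 μ where
  toFun c := (memLp_comp_of_finite hσ c).toLp
  map_add' _ _ := rfl
  map_smul' _ _ := rfl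

end Lp

variable {E F : Type*} [NormedAddCommGroup E] [NormedSpace ℝ E] [FiniteDimensional ℝ E]
  [MeasurableSpace E] [BorelSpace E] (μ : Measure E) [μ.IsAddHaarMeasure] [NormedAddCommGroup F]
  [NormedSpace ℝ F] [CompleteSpace F] {φ : E → F}

theorem enorm_sub_average_ball_sq_le (hφ : Continuous φ) {x y : E} {ε : ℝ} (hε : 0 < ε)
    (hxy : dist y x ≤ ε) :
    ‖φ x - ⨍ z in Metric.ball y ε, φ z ∂μ‖ₑ ^ 2 ≤
      (μ (Metric.ball 0 ε))⁻¹ * ∫⁻ h in Metric.ball 0 (2 * ε), ‖φ (x + h) - φ x‖ₑ ^ 2 ∂μ := by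
  have : NeZero (μ.restrict (Metric.ball y ε)) :=
    ⟨Measure.restrict_eq_zero.not.2 (Metric.measure_ball_pos μ y hε).ne'⟩
  have : IsFiniteMeasure (μ.restrict (Metric.ball y ε)) := ⟨by simp [measure_ball_lt_top]⟩
  have hint : IntegrableOn φ (Metric.ball y ε) μ :=
    (hφ.continuousOn.integrableOn_compact (isCompact_closedBall y ε)).mono_set
      Metric.ball_subset_closedBall
  have hball : Metric.ball y ε ⊆ Metric.ball x (2 * ε) :=
    Metric.ball_subset_ball' (by linarith)
  calc ‖φ x - ⨍ z in Metric.ball y ε, φ z ∂μ‖ₑ ^ 2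
      ≤ ⨍⁻ z in Metric.ball y ε, ‖φ x - φ z‖ₑ ^ 2 ∂μ := enorm_sub_average_sq_le hint _
    _ = (μ (Metric.ball 0 ε))⁻¹ * ∫⁻ z in Metric.ball y ε, ‖φ x - φ z‖ₑ ^ 2 ∂μ := by
        rw [setLAverage_eq, ENNReal.div_eq_inv_mul, Measure.addHaar_ball_center]
    _ ≤ (μ (Metric.ball 0 ε))⁻¹ * ∫⁻ z in Metric.ball x (2 * ε), ‖φ z - φ x‖ₑ ^ 2 ∂μ := by
        simp only [enorm_sub_rev (φ x)]
        gcongr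
    _ = _ := by
        rw [← (measurePreserving_add_left μ x).setLIntegral_comp_preimage_emb
          (measurableEmbedding_addLeft x)]
        simp

theorem lintegral_sub_average_ball_sq_le (hφ : ContDiff ℝ 1 φ) {S : Set E} {σ : E → E} {ε : ℝ}
    (hε : 0 < ε) (hS : MeasurableSet S) (hσ : ∀ x ∈ S, dist (σ x) x ≤ ε) :
    ∫⁻ x in S, ‖φ x - ⨍ z in Metric.ball (σ x) ε, φ z ∂μ‖ₑ ^ 2 ∂μ ≤
      ENNReal.ofReal (2 ^ Module.finrank ℝ E * (2 * ε) ^ 2) * ∫⁻ x, ‖fderiv ℝ φ x‖ₑ ^ 2 ∂μ := by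
  have hcont : Continuous fun z : E × E => φ (z.1 + z.2) - φ z.1 := by
    have := hφ.continuous
    fun_prop
  have hinv : (μ (Metric.ball 0 ε))⁻¹ ≠ ⊤ :=
    ENNReal.inv_ne_top.2 (Metric.measure_ball_pos μ 0 hε).ne'
  set I := ∫⁻ x, ‖fderiv ℝ φ x‖ₑ ^ 2 ∂μ
  calc ∫⁻ x in S, ‖φ x - ⨍ z in Metric.ball (σ x) ε, φ z ∂μ‖ₑ ^ 2 ∂μ
      ≤ ∫⁻ x in S, (μ (Metric.ball 0 ε))⁻¹ *
          (∫⁻ h in Metric.ball 0 (2 * ε), ‖φ (x + h) - φ x‖ₑ ^ 2 ∂μ) ∂μ :=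
        setLIntegral_mono' hS fun x hx =>
          enorm_sub_average_ball_sq_le μ hφ.continuous hε (hσ x hx)
    _ ≤ ∫⁻ x, (μ (Metric.ball 0 ε))⁻¹ *
          (∫⁻ h in Metric.ball 0 (2 * ε), ‖φ (x + h) - φ x‖ₑ ^ 2 ∂μ) ∂μ :=
        setLIntegral_le_lintegral _ _
    _ = (μ (Metric.ball 0 ε))⁻¹ *
          ∫⁻ h in Metric.ball 0 (2 * ε), (∫⁻ x, ‖φ (x + h) - φ x‖ₑ ^ 2 ∂μ) ∂μ := by
        rw [lintegral_const_mul' _ _ hinv,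
          lintegral_lintegral_swap (hcont.enorm.measurable.pow_const 2).aemeasurable]
    _ ≤ (μ (Metric.ball 0 ε))⁻¹ *
          ∫⁻ h in Metric.ball (0 : E) (2 * ε), ENNReal.ofReal ((2 * ε) ^ 2) * I ∂μ := by
        refine mul_le_mul_right (setLIntegral_mono' measurableSet_ball fun h hh =>
          (lintegral_enorm_translate_sub_sq_le μ hφ h).trans ?_) _
        rw [ENNReal.ofReal_pow (by positivity), ← ofReal_norm]
        gcongr
        exact (mem_ball_zero_iff.1 hh).le
    _ = ENNReal.ofReal (2 ^ Module.finrank ℝ E * (2 * ε) ^ 2) * I := by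
        rw [setLIntegral_const, Measure.addHaar_ball_mul_of_pos μ 0 two_pos, mul_comm,
          ENNReal.ofReal_mul (by positivity), mul_assoc, mul_assoc,
          ENNReal.mul_inv_cancel_right (Metric.measure_ball_pos μ 0 hε).ne'
            measure_ball_lt_top.ne]
        ring

end StepApproximation

section TestFields

variable {d : ℕ} {Ω : Set (Pt d)}

theorem enorm_fderiv_le_enorm_jacobian (φ : Pt d → Pt d) (x : Pt d) :
    ‖fderiv ℝ φ x‖ₑ ≤ ‖jacobian φ x‖ₑ := by
  refine enorm_le_iff_norm_le.2 (ContinuousLinearMap.opNorm_le_bound _ (norm_nonneg _) fun v => ?_)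
  refine le_of_sq_le_sq ?_ (by positivity)
  have hv : ∀ i, fderiv ℝ φ x v i = ∑ j, fderiv ℝ φ x (EuclideanSpace.single j 1) i * v j := by
    intro i
    conv_lhs => rw [← (EuclideanSpace.basisFun (Fin d) ℝ).sum_repr v]
    simp [mul_comm]
  rw [mul_pow, EuclideanSpace.norm_sq_eq, EuclideanSpace.norm_sq_eq, EuclideanSpace.norm_sq_eq,
    Fintype.sum_prod_type, Finset.sum_mul]
  refine Finset.sum_le_sum fun i _ => ?_
  simp only [Real.norm_eq_abs, sq_abs, jacobian, hv]
  exact Finset.sum_mul_sq_le_sq_mul_sq _ _ _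

theorem jacobian_zero : jacobian (0 : Pt d → Pt d) = 0 := by
  ext x ij
  simp [jacobian]

theorem jacobian_add {φ ψ : Pt d → Pt d} (hφ : Differentiable ℝ φ) (hψ : Differentiable ℝ ψ) :
    jacobian (φ + ψ) = jacobian φ + jacobian ψ := by
  ext x ij
  simp [jacobian, fderiv_add (hφ x) (hψ x)]

theorem jacobian_const_smul {φ : Pt d → Pt d} (hφ : Differentiable ℝ φ) (c : ℝ) :
    jacobian (c • φ) = c • jacobian φ := by
  ext x ij
  simp [jacobian, fderiv_const_smul (hφ x)]

theorem mem_testPairs_of_mem_span {w : L2Field Ω × L2Tensor Ω}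
    (hw : w ∈ Submodule.span ℝ (testPairs Ω)) : w ∈ testPairs Ω := by
  induction hw using Submodule.span_induction with
  | mem _ hw => exact hw
  | zero =>
    refine ⟨0, contDiff_zero_fun, .zero, by simp [tsupport], Lp.coeFn_zero _ _ _, ?_⟩
    rw [jacobian_zero]
    exact Lp.coeFn_zero _ _ _
  | add w z _ _ hw hz =>
    obtain ⟨φ, hφ, hφc, hφΩ, h1, h2⟩ := hw
    obtain ⟨ψ, hψ, hψc, hψΩ, h3, h4⟩ := hz
    refine ⟨φ + ψ, hφ.add hψ, hφc.add hψc,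
      (tsupport_add φ ψ).trans (Set.union_subset hφΩ hψΩ), (Lp.coeFn_add _ _).trans (h1.add h3), ?_⟩
    rw [jacobian_add (hφ.differentiable (by simp)) (hψ.differentiable (by simp))]
    exact (Lp.coeFn_add _ _).trans (h2.add h4)
  | smul c w _ hw =>
    obtain ⟨φ, hφ, hφc, hφΩ, h1, h2⟩ := hw
    refine ⟨c • φ, hφ.const_smul c, hφc.smul_left (f := fun _ => c),
      (tsupport_smul_subset_right (fun _ => c) φ).trans hφΩ,
      (Lp.coeFn_smul _ _).trans (h1.const_smul c), ?_⟩
    rw [jacobian_const_smul (hφ.differentiable (by simp))]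
    exact (Lp.coeFn_smul _ _).trans (h2.const_smul c)

theorem mem_of_isClosed_of_testPairs_subset {S : Set (L2Field Ω × L2Tensor Ω)} (hS : IsClosed S)
    (h : testPairs Ω ⊆ S) (v : VelocitySpace Ω) : v.1 ∈ S :=
  closure_minimal (fun _ hw => h (mem_testPairs_of_mem_span hw)) hS v.2

theorem enorm_sq_eq_lintegral {α F : Type*} [MeasurableSpace α] {μ : Measure α}
    [NormedAddCommGroup F] (f : Lp F 2 μ) {φ : α → F} (h : f =ᵐ[μ] φ) :
    ‖f‖ₑ ^ 2 = ∫⁻ x, ‖φ x‖ₑ ^ 2 ∂μ := by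
  rw [Lp.enorm_def, eLpNorm_congr_ae h]
  simpa using eLpNorm_nnreal_pow_eq_lintegral (f := φ) (p := 2) (μ := μ) two_ne_zero

theorem exists_contDiff_of_mem_testPairs {w : L2Field Ω × L2Tensor Ω} (hw : w ∈ testPairs Ω) :
    ∃ φ : Pt d → Pt d, ContDiff ℝ 1 φ ∧ (∀ x ∉ Ω, φ x = 0) ∧ w.1 =ᵐ[volume.restrict Ω] φ ∧
      ∫⁻ x, ‖fderiv ℝ φ x‖ₑ ^ 2 ≤ ‖w.2‖ₑ ^ 2 := by
  obtain ⟨φ, hφ, -, hφΩ, hval, hgrad⟩ := hw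
  refine ⟨φ, hφ.of_le (by simp), fun x hx => image_eq_zero_of_notMem_tsupport fun h => hx (hφΩ h),
    hval, ?_⟩
  have hsupp : (Function.support fun x => ‖fderiv ℝ φ x‖ₑ ^ 2) ⊆ Ω := fun x hx =>
    hφΩ (support_fderiv_subset ℝ fun h => hx (by simp [← ofReal_norm, h]))
  rw [enorm_sq_eq_lintegral _ hgrad, ← setLIntegral_eq_of_support_subset hsupp]
  refine lintegral_mono fun x => ?_
  gcongr
  exact enorm_fderiv_le_enorm_jacobian φ x

theorem norm_le_mul_norm_of_enorm_sq_le {A B : Type*} [NormedAddCommGroup A]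
    [NormedAddCommGroup B] {a : A} {b : B} {c : ℝ} (hc : 0 ≤ c)
    (h : ‖a‖ₑ ^ 2 ≤ ENNReal.ofReal (c ^ 2) * ‖b‖ₑ ^ 2) : ‖a‖ ≤ c * ‖b‖ := by
  rw [← ofReal_norm, ← ofReal_norm, ← ENNReal.ofReal_pow (norm_nonneg _),
    ← ENNReal.ofReal_pow (norm_nonneg _), ← ENNReal.ofReal_mul (sq_nonneg _),
    ENNReal.ofReal_le_ofReal_iff (by positivity), ← mul_pow] at h
  exact le_of_sq_le_sq h (by positivity)

theorem exists_norm_val_le (hΩ : Bornology.IsBounded Ω) :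
    ∃ C : ℝ, ∀ v : VelocitySpace Ω, ‖val v‖ ≤ C * ‖grad v‖ := by
  rcases subsingleton_or_nontrivial (Pt d) with hd | hd
  · refine ⟨1, fun v => ?_⟩
    have hv : val v = 0 := Lp.ext (.of_forall fun _ => Subsingleton.elim _ _)
    simp [hv]
  obtain ⟨h, hh⟩ := NormedSpace.exists_lt_norm ℝ (Pt d) (Metric.diam Ω)
  refine ⟨‖h‖, mem_of_isClosed_of_testPairs_subset
    (S := {w | ‖w.1‖ ≤ ‖h‖ * ‖w.2‖}) (isClosed_le (by fun_prop) (by fun_prop)) fun w hw => ?_⟩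
  obtain ⟨φ, hφ, hφ0, hval, hgrad⟩ := exists_contDiff_of_mem_testPairs hw
  have hdisj : ∀ x ∈ Ω, x + h ∉ Ω := fun x hx hxh =>
    (Metric.dist_le_diam_of_mem hΩ hxh hx).not_gt (by simpa using hh)
  refine norm_le_mul_norm_of_enorm_sq_le (norm_nonneg h) ?_
  calc ‖w.1‖ₑ ^ 2 = ∫⁻ x in Ω, ‖φ x‖ₑ ^ 2 := enorm_sq_eq_lintegral _ hval
    _ ≤ ∫⁻ x, ‖φ x‖ₑ ^ 2 := setLIntegral_le_lintegral _ _
    _ ≤ ∫⁻ x, ‖φ (x + h) - φ x‖ₑ ^ 2 := lintegral_mono fun x => by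
        by_cases hx : x ∈ Ω
        · simp [hφ0 _ (hdisj x hx)]
        · simp [hφ0 x hx]
    _ ≤ ‖h‖ₑ ^ 2 * ∫⁻ x, ‖fderiv ℝ φ x‖ₑ ^ 2 := lintegral_enorm_translate_sub_sq_le _ hφ h
    _ ≤ ENNReal.ofReal (‖h‖ ^ 2) * ‖w.2‖ₑ ^ 2 := by
        rw [ENNReal.ofReal_pow (norm_nonneg _), ofReal_norm]
        gcongr

theorem exists_approximation_testPairs (hΩ : Bornology.IsBounded Ω) {ε : ℝ} (hε : 0 < ε) :
    ∃ (W : Submodule ℝ (L2Field Ω)) (_ : FiniteDimensional ℝ W),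
      ∀ w ∈ testPairs Ω, ∃ s ∈ W, ‖w.1 - s‖ ≤ ε * ‖w.2‖ := by
  have : IsFiniteMeasure (volume.restrict Ω) := ⟨by simpa using hΩ.measure_lt_top⟩
  obtain ⟨R, hR⟩ := hΩ.subset_ball 0
  set A : ℝ := 2 ^ Module.finrank ℝ (Pt d)
  have hA : 0 < A := by positivity
  set δ := ε / (2 * √A) with hδ
  have hδ0 : 0 < δ := by positivity
  have hAδ : A * (2 * δ) ^ 2 = ε ^ 2 := by
    rw [hδ, mul_pow, div_pow, mul_pow, Real.sq_sqrt hA.le]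
    field_simp
  obtain ⟨σ, hσ⟩ := exists_simpleFunc_dist_lt (Metric.isBounded_ball (x := (0 : Pt d)) (r := R)) hδ0
  have hσ' : Measurable fun x => (⟨σ x, σ.mem_range_self x⟩ : σ.range) := σ.measurable.subtype_mk
  refine ⟨LinearMap.range (stepLp (volume.restrict Ω) hσ'), inferInstance, fun w hw => ?_⟩
  obtain ⟨φ, hφ, -, hval, hgrad⟩ := exists_contDiff_of_mem_testPairs hw
  set c : σ.range → Pt d := fun y => ⨍ z in Metric.ball y.1 δ, φ z
  have hsub : (w.1 - stepLp _ hσ' c : L2Field Ω) =ᵐ[volume.restrict Ω]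
      fun x => φ x - ⨍ z in Metric.ball (σ x) δ, φ z :=
    (Lp.coeFn_sub _ _).trans (hval.sub (MemLp.coeFn_toLp (memLp_comp_of_finite hσ' c)))
  refine ⟨_, LinearMap.mem_range_self _ c, norm_le_mul_norm_of_enorm_sq_le hε.le ?_⟩
  calc ‖w.1 - stepLp _ hσ' c‖ₑ ^ 2
      = ∫⁻ x in Ω, ‖φ x - ⨍ z in Metric.ball (σ x) δ, φ z‖ₑ ^ 2 := enorm_sq_eq_lintegral _ hsub
    _ ≤ ∫⁻ x in Metric.ball 0 R, ‖φ x - ⨍ z in Metric.ball (σ x) δ, φ z‖ₑ ^ 2 :=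
        lintegral_mono_set hR
    _ ≤ ENNReal.ofReal (A * (2 * δ) ^ 2) * ∫⁻ x, ‖fderiv ℝ φ x‖ₑ ^ 2 :=
        lintegral_sub_average_ball_sq_le _ hφ hδ0 measurableSet_ball fun x hx => (hσ x hx).le
    _ ≤ ENNReal.ofReal (ε ^ 2) * ‖w.2‖ₑ ^ 2 := by
        rw [hAδ]
        gcongr

theorem exists_norm_val_sub_starProjection_le (hΩ : Bornology.IsBounded Ω) {ε : ℝ} (hε : 0 < ε) :
    ∃ (W : Submodule ℝ (L2Field Ω)) (_ : FiniteDimensional ℝ W),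
      ∀ v : VelocitySpace Ω, ‖val v - W.starProjection (val v)‖ ≤ ε * ‖grad v‖ := by
  obtain ⟨W, hW, happrox⟩ := exists_approximation_testPairs hΩ hε
  refine ⟨W, hW, mem_of_isClosed_of_testPairs_subset
    (S := {w | ‖w.1 - W.starProjection w.1‖ ≤ ε * ‖w.2‖})
    (isClosed_le (by fun_prop) (by fun_prop)) fun w hw => ?_⟩
  obtain ⟨s, hs, hws⟩ := happrox w hw
  refine le_trans ?_ hws
  rw [Submodule.starProjection_minimal]
  exact ciInf_le ⟨0, by rintro _ ⟨x, rfl⟩; positivity⟩ (⟨s, hs⟩ : W)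

end TestFields

section Snapshots

theorem exists_isMomentMatrix_gram {V H F F' : Type*} [AddCommGroup V] [Module ℝ V]
    [NormedAddCommGroup H] [InnerProductSpace ℝ H] [NormedAddCommGroup F] [InnerProductSpace ℝ F]
    [CompleteSpace F] [NormedAddCommGroup F'] [NormedSpace ℝ F'] [FiniteDimensional ℝ F']
    {G : V →ₗ[ℝ] H} {J : V →ₗ[ℝ] F} {C ε ν : ℝ} (hG : Function.Injective G)
    (hC : ∀ v, ‖J v‖ ≤ C * ‖G v‖) (P : F →ₗ[ℝ] F') (hP : ∀ v, P (J v) = 0 → ‖J v‖ ≤ ε * ‖G v‖)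
    (hν : 0 < ν) {n : ℕ} (hn : 0 < n) {x : Fin n → V} (hx : ∀ i j k : Fin n, (j : ℕ) = i + 1 →
      ν * inner ℝ (G (x j)) (G (x k)) = inner ℝ (J (x i)) (J (x k))) :
    ∃ (N : ℕ) (w θ : Fin N → ℝ), IsMomentMatrix (ν • Matrix.gram ℝ fun i => G (x i)) w θ ∧
      (∀ l, θ l ≤ C ^ 2 / ν) ∧ {l | ε ^ 2 / ν < θ l}.ncard ≤ Module.finrank ℝ F' := by
  set K := Submodule.span ℝ (Set.range x)
  have : FiniteDimensional ℝ K := .span_of_finite ℝ (Set.finite_range x)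
  obtain ⟨b, μ, hb⟩ := exists_diagonalizes (J ∘ₗ K.subtype) (G := G ∘ₗ K.subtype)
    (hG.comp K.subtype_injective)
  have hrec : ∀ i j : Fin n, (j : ℕ) = i + 1 → ∀ v ∈ K,
      ν * inner ℝ (G (x j)) (G v) = inner ℝ (J (x i)) (J v) := by
    intro i j hij v hv
    induction hv using Submodule.span_induction with
    | mem v hv =>
      obtain ⟨k, rfl⟩ := hv
      exact hx i j k hij
    | zero => simp
    | add v w _ _ hv hw => simp only [map_add, inner_add_right, mul_add, hv, hw]
    | smul c v _ hv => simp only [map_smul, inner_smul_right, mul_left_comm ν, hv]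
  refine ⟨_, _, _, hb.isMomentMatrix hν hn
    (x := fun i => ⟨x i, Submodule.subset_span (Set.mem_range_self i)⟩)
    fun i j hij v => hrec i j hij v v.2, fun l => ?_, ?_⟩
  · gcongr
    exact hb.eigenvalue_le (fun v => hC v) l
  · simpa only [div_lt_div_iff_of_pos_right hν] using hb.ncard_eigenvalue_le P fun v => hP v

variable {d : ℕ} {Ω : Set (Pt d)} {C ν : ℝ} {f : L2Field Ω} {Vh : Submodule ℝ (VelocitySpace Ω)}
  {Qh : Submodule ℝ (PressureSpace Ω)} {N : ℕ} {φ : Module.Basis (Fin N) ℝ Vh} {ℓ r : ℕ}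
  {u : ℕ → Vh} {p : ℕ → Qh}

/-- `grad` as a linear map. -/
noncomputable def gradLinear (Ω : Set (Pt d)) : VelocitySpace Ω →ₗ[ℝ] L2Tensor Ω :=
  LinearMap.snd ℝ _ _ ∘ₗ (H10 Ω).subtype

/-- `val` as a linear map. -/
noncomputable def valLinear (Ω : Set (Pt d)) : VelocitySpace Ω →ₗ[ℝ] L2Field Ω :=
  LinearMap.fst ℝ _ _ ∘ₗ (H10 Ω).subtype

theorem gradLinear_injective (hC : ∀ v : VelocitySpace Ω, ‖val v‖ ≤ C * ‖grad v‖) :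
    Function.Injective (gradLinear Ω) := by
  refine (injective_iff_map_eq_zero _).2 fun v hv => Subtype.ext (Prod.ext ?_ hv)
  exact norm_le_zero_iff.1 ((hC v).trans_eq (by rw [show grad v = 0 from hv]; simp))

theorem inner_le_dualNorm_mul (hC : ∀ v : VelocitySpace Ω, ‖val v‖ ≤ C * ‖grad v‖)
    (f : L2Field Ω) (v : VelocitySpace Ω) : inner ℝ f (val v) ≤ dualNorm f * ‖grad v‖ := by
  have hbdd : BddAbove (Set.range fun v : VelocitySpace Ω => inner ℝ f (val v) / normV v) := by
    refine ⟨‖f‖ * |C|, ?_⟩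
    rintro _ ⟨v, rfl⟩
    refine div_le_of_le_mul₀ (norm_nonneg _) (by positivity) ((real_inner_le_norm _ _).trans ?_)
    rw [mul_assoc]
    gcongr
    exact (hC v).trans (mul_le_mul_of_nonneg_right (le_abs_self C) (norm_nonneg _))
  rcases (norm_nonneg (grad v)).eq_or_lt' with h | h
  · have hval : val v = 0 := norm_le_zero_iff.1 ((hC v).trans_eq (by rw [h, mul_zero]))
    simp [hval, h]
  · exact (div_le_iff₀ h).1 (le_ciSup hbdd v)

theorem snapshotGram_eq_smul_gram (ν : ℝ) (φ : Module.Basis (Fin N) ℝ Vh) (u : ℕ → Vh) (r : ℕ) :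
    snapshotGram ν φ u r = ν • Matrix.gram ℝ fun i : Fin r => gradLinear Ω (u i).1 := by
  have hcoeff : ∀ i, gradLinear Ω (u i).1 = ∑ a, φ.repr (u i) a • gradLinear Ω (φ a).1 := by
    intro i
    conv_lhs => rw [← φ.sum_repr (u i)]
    simp only [Submodule.coe_sum, Submodule.coe_smul, map_sum, map_smul]
  ext i j
  rw [Matrix.smul_apply, Matrix.gram_apply, real_inner_comm, hcoeff, hcoeff, sum_inner,
    smul_eq_mul, Finset.mul_sum]
  simp only [snapshotGram, Matrix.mul_apply, Finset.sum_mul, Matrix.transpose_apply, coeffMatrix,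
    stiffness, Matrix.of_apply, formA, inner_sum, Finset.mul_sum, inner_smul_left,
    inner_smul_right, conj_trivial]
  refine Finset.sum_congr rfl fun b _ => Finset.sum_congr rfl fun a _ => ?_
  change _ * (ν * inner ℝ (gradLinear Ω (φ b).1) (gradLinear Ω (φ a).1)) * _ = _
  ring

theorem posDef_snapshotGram (hC : ∀ v : VelocitySpace Ω, ‖val v‖ ≤ C * ‖grad v‖) (hν : 0 < ν)
    (hu : LinearIndependent ℝ fun i : Fin r => u i) : (snapshotGram ν φ u r).PosDef := by
  have hgrad : LinearIndependent ℝ fun i : Fin r => gradLinear Ω (u i).1 :=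
    hu.map_injOn (gradLinear Ω ∘ₗ Vh.subtype)
      ((gradLinear_injective hC).comp Vh.subtype_injective).injOn
  rw [snapshotGram_eq_smul_gram]
  exact (Matrix.posDef_gram_of_linearIndependent hgrad).smul hν

namespace IsSnapshotSequence

theorem mul_inner_grad (hu : IsSnapshotSequence ν f ℓ u p) {i j : ℕ} (hi : i < ℓ) (hj : j < ℓ) :
    ν * inner ℝ (grad (u i).1) (grad (u j).1) = inner ℝ (load f u i) (val (u j).1) := by
  have h := (hu i hi).1 (u j)
  rwa [(hu j hj).2, add_zero] at h

theorem mul_norm_grad_zero_sq_le (hu : IsSnapshotSequence ν f ℓ u p)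
    (hC : ∀ v : VelocitySpace Ω, ‖val v‖ ≤ C * ‖grad v‖) (hν : 0 < ν) (hℓ : 0 < ℓ) :
    ν * ‖grad (u 0).1‖ ^ 2 ≤ dualNorm f ^ 2 / ν := by
  have hload : ν * ‖grad (u 0).1‖ ^ 2 ≤ dualNorm f * ‖grad (u 0).1‖ := by
    rw [← real_inner_self_eq_norm_sq, hu.mul_inner_grad hℓ hℓ]
    exact inner_le_dualNorm_mul hC f _
  rw [le_div_iff₀ hν]
  nlinarith [sq_nonneg (dualNorm f - ν * ‖grad (u 0).1‖)]

theorem exists_isMomentMatrix (hu : IsSnapshotSequence ν f ℓ u p) (φ : Module.Basis (Fin N) ℝ Vh)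
    (hC : ∀ v : VelocitySpace Ω, ‖val v‖ ≤ C * ‖grad v‖) {W : Submodule ℝ (L2Field Ω)}
    [FiniteDimensional ℝ W] {ε : ℝ}
    (hW : ∀ v : VelocitySpace Ω, ‖val v - W.starProjection (val v)‖ ≤ ε * ‖grad v‖)
    (hν : 0 < ν) (hr : 0 < r) (hrℓ : r ≤ ℓ) :
    ∃ (M : ℕ) (w θ : Fin M → ℝ), IsMomentMatrix (snapshotGram ν φ u r) w θ ∧
      (∀ l, θ l ≤ C ^ 2 / ν) ∧ {l | ε ^ 2 / ν < θ l}.ncard ≤ Module.finrank ℝ W ∧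
      ∑ l, w l ≤ dualNorm f ^ 2 / ν := by
  have hker : ∀ v : VelocitySpace Ω, W.orthogonalProjectionOnto (val v) = 0 →
      ‖val v‖ ≤ ε * ‖grad v‖ := fun v hv => by
    simpa [Submodule.starProjection_apply, hv] using hW v
  obtain ⟨M, w, θ, hK, hθC, hcard⟩ := exists_isMomentMatrix_gram (gradLinear_injective hC)
    (J := valLinear Ω) hC W.orthogonalProjectionOnto.toLinearMap hker hν hr
    (x := fun i : Fin r => (u i).1) fun i j k hij => by
      rw [hij]
      exact hu.mul_inner_grad (i := i + 1) (by omega) (by omega)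
  rw [← snapshotGram_eq_smul_gram ν φ u r] at hK
  refine ⟨M, w, θ, hK, hθC, hcard, ?_⟩
  rw [hK.sum_weight_eq hr, snapshotGram_eq_smul_gram, Matrix.smul_apply, Matrix.gram_apply,
    real_inner_self_eq_norm_sq]
  exact hu.mul_norm_grad_zero_sq_le hC hν (hr.trans_le hrℓ)

end IsSnapshotSequence

end Snapshots

end StokesROM

open StokesROM in
theorem theorem4p1_general {d : ℕ} {Ω : Set (Pt d)} (hΩ : Bornology.IsBounded Ω) {ν : ℝ}
    (hν : 0 < ν) {κ : ℝ} (hκ : 0 ≤ κ) :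
    ∃ C : ℝ, 0 < C ∧
      ∀ (f : L2Field Ω) (Vh : Submodule ℝ (VelocitySpace Ω)) (Qh : Submodule ℝ (PressureSpace Ω))
        (N : ℕ) (φ : Module.Basis (Fin N) ℝ Vh) (ℓ : ℕ) (u : ℕ → Vh) (p : ℕ → Qh)
        (_ : IsSnapshotSequence ν f ℓ u p) (r : ℕ) (hr : 1 ≤ r) (_ : r ≤ ℓ)
        (_ : LinearIndependent ℝ fun i : Fin r => u i),
        (∀ i j i' j' : Fin r, (i : ℕ) + j = i' + j' →
          snapshotGram ν φ u r i j = snapshotGram ν φ u r i' j') ∧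
        ∃ hK : (snapshotGram ν φ u r).IsHermitian,
          0 < sortedEigenvalue hK ⟨r - 1, Nat.sub_one_lt_of_lt hr⟩ ∧
          (∀ (k : ℕ) (hk : 2 * k + 1 ≤ r),
            sortedEigenvalue hK ⟨2 * k, hk⟩ ≤
              16 * hankelRate r ^ (-2 * (k : ℤ) + 2) * sortedEigenvalue hK ⟨0, hr⟩) ∧
          sortedEigenvalue hK ⟨r - 1, Nat.sub_one_lt_of_lt hr⟩ ≤
            C * (2 * (r : ℝ) - 1) * dualNorm f ^ 2 * Real.exp (-(κ * ((r : ℝ) + 1) / 2)) := by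
  obtain ⟨C, hC⟩ := exists_norm_val_le hΩ
  obtain ⟨W, _, hW⟩ := exists_norm_val_sub_starProjection_le hΩ
    (ε := √(ν * Real.exp (-(κ / 4)))) (by positivity)
  set L := max 1 (C ^ 2 / ν)
  set D := Real.exp (κ * (Module.finrank ℝ W + 2) / 2) * L ^ (2 * Module.finrank ℝ W)
  refine ⟨D / ν, by positivity, fun f Vh Qh N φ ℓ u p hu r hr hrℓ hlin => ?_⟩
  obtain ⟨M, w, θ, hK, hθ, hlarge, hmass⟩ := hu.exists_isMomentMatrix φ hC hW hν hr hrℓ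
  rw [Real.sq_sqrt (by positivity), mul_div_cancel_left₀ _ hν.ne'] at hlarge
  refine ⟨fun i j i' j' hij => by rw [hK.apply_eq, hK.apply_eq, hij], hK.isHermitian,
    sortedEigenvalue_pos (posDef_snapshotGram hC hν hlin) _,
    fun k hk => hK.sortedEigenvalue_two_mul_le hk, ?_⟩
  have hr1 : (1 : ℝ) ≤ 2 * r - 1 := by
    have : (1 : ℝ) ≤ r := mod_cast hr
    linarith
  calc sortedEigenvalue hK.isHermitian ⟨r - 1, Nat.sub_one_lt_of_lt hr⟩
      ≤ D * Real.exp (-(κ * ((r : ℝ) + 1) / 2)) * ∑ l, w l :=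
        hK.sortedEigenvalue_last_le_exp hr hκ (le_max_left _ _)
          (fun l => (hθ l).trans (le_max_right _ _)) hlarge
    _ ≤ D * Real.exp (-(κ * ((r : ℝ) + 1) / 2)) * (dualNorm f ^ 2 / ν) := by gcongr
    _ ≤ D * Real.exp (-(κ * ((r : ℝ) + 1) / 2)) * (dualNorm f ^ 2 / ν) * (2 * r - 1) :=
        le_mul_of_one_le_right (by positivity) hr1
    _ = _ := by ring

theorem theorem4p1 (d : ℕ) (hd : d = 2 ∨ d = 3) (Ω : Set (StokesROM.Pt d))
    (hΩo : IsOpen Ω) (hΩb : Bornology.IsBounded Ω) (ν : ℝ) (hν : 0 < ν) :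
    ∃ C : ℝ, 0 < C ∧
      ∀ (f : StokesROM.L2Field Ω)
        (Vh : Submodule ℝ (StokesROM.VelocitySpace Ω))
        (Qh : Submodule ℝ (StokesROM.PressureSpace Ω)) (_ : FiniteDimensional ℝ Qh)
        (_ : StokesROM.DiscreteInfSup Vh Qh)
        (N : ℕ) (φ : Module.Basis (Fin N) ℝ Vh)
        (ℓ : ℕ) (u : ℕ → Vh) (p : ℕ → Qh) (_ : StokesROM.IsSnapshotSequence ν f ℓ u p)
        (r : ℕ) (hr : 1 ≤ r) (_ : r ≤ ℓ) (_ : LinearIndependent ℝ (fun i : Fin r => u i)),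
        (∀ i j i' j' : Fin r, (i : ℕ) + j = i' + j' →
          StokesROM.snapshotGram ν φ u r i j = StokesROM.snapshotGram ν φ u r i' j') ∧
        ∃ hK : (StokesROM.snapshotGram ν φ u r).IsHermitian,
          0 < StokesROM.sortedEigenvalue hK ⟨r - 1, by omega⟩ ∧
          (∀ (k : ℕ) (hk : 2 * k + 1 ≤ r),
            StokesROM.sortedEigenvalue hK ⟨2 * k, by omega⟩ ≤
              16 * Real.exp (Real.pi ^ 2 / (4 * Real.log (8 * ((r / 2 : ℕ) : ℝ) / Real.pi)))
                    ^ (-2 * (k : ℤ) + 2) *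
                StokesROM.sortedEigenvalue hK ⟨0, by omega⟩) ∧
          StokesROM.sortedEigenvalue hK ⟨r - 1, by omega⟩ ≤
            C * (2 * (r : ℝ) - 1) * StokesROM.dualNorm f ^ 2 *
              Real.exp (-(7 * ((r : ℝ) + 1) / 2)) := by
  obtain ⟨C, hC, h⟩ := theorem4p1_general hΩb hν (κ := 7) (by norm_num)
  exact ⟨C, hC, fun f Vh Qh _ _ => h f Vh Qh⟩
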